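/- Let $\alpha>0$. Let $\mathcal F=\bigoplus_{n\ge 0}L^2_{\rm sym}((\mathbb R^3)^n)$ be the bosonic Fock space over $L^2(\mathbb R^3)$ in the momentum representation, let $N$ be the number operator and $P_f$ the phonon momentum, so that on $n$-phonon functions $N$ acts as multiplication by $n$ and $P_f$ as multiplication by $k_1+\dots+k_n$, and let $a(f),a^*(f)$ be the usual annihilation and creation operators with form factor $f$, $(a(f)\Psi)^{(n)}(k_1,\dots,k_n)=\sqrt{n+1}\int_{\mathbb R^3}\overline{f(k)}\,\Psi^{(n+1)}(k,k_1,\dots,k_n)\,dk$. Put $\hat v(k)=(4\pi|k|)^{-1}$ and $\hat v_\Lambda(k)=\hat v(k)\,\chi_{[0,\Lambda)}(|k|)$ for $k\in\mathbb R^3$. For $P\in\mathbb R^3$ let $H_0=(P-P_f)^2+N+1$, with its natural (maximal) domain $D(H_0)$ as a multiplication operator, and let $H(P)$, formally $(P-P_f)^2+N+\sqrt\alpha\,(a(\hat v)+a^*(\hat v))$, be defined as the operator such that $H(P)+1$ is associated with the quadratic form $$Q_P(\Psi)=\big\langle\Psi,\big((P-P_f)^2+N+1\big)\Psi\big\rangle+2\sqrt\alpha\,\operatorname{Re}\langle\Psi,a(\hat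 v)\Psi\rangle,\qquad \Psi\in D(H_0^{1/2}),$$ where $\langle\Phi,a(\hat v)\Psi\rangle=\sum_{n}\sqrt{n+1}\int\overline{\Phi^{(n)}(k_1,\dots,k_n)}\,\overline{\hat v(k)}\,\Psi^{(n+1)}(k,k_1,\dots,k_n)\,dk\,dk_1\cdots dk_n$. That is, with $Q_P(\Phi,\Psi)$ the corresponding sesquilinear form (linear in $\Psi$), $\Psi\in D(H(P))$ and $H(P)\Psi=\eta\in\mathcal F$ if and only if $\Psi\in D(H_0^{1/2})$ and $Q_P(\Phi,\Psi)=\langle\Phi,\eta+\Psi\rangle$ for all $\Phi\in D(H_0^{1/2})$. Then for every $\Lambda>0$ and $P\in\mathbb R^3$ the operator $$H_\Lambda(P)=(P-P_f)^2+N+\sqrt\alpha\,\big(a(\hat v_\Lambda)+a^*(\hat v_\Lambda)\big)$$ is well defined and self-adjoint with domain $D(H_\Lambda(P))=D(H_0)$, the operator $H(P)$ is self-adjoint for every $P\in\mathbb R^3$, and $H_\Lambda(P)$ converges to $H(P)$ in norm-resolvent sense as $\Lambda\to\infty$, uniformly in $P\in\mathbb R^3$: for every $z\in\mathbb C\setminus\mathbb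 R$, $$\lim_{\Lambda\to\infty}\ \sup_{P\in\mathbb R^3}\big\|(H_\Lambda(P)-z)^{-1}-(H(P)-z)^{-1}\big\|=0 .$$ -/

import Mathlib

open MeasureTheory Filter Topology ComplexConjugate

noncomputable section

namespace Polaron

/-! ### The bosonic Fock space over `L²(ℝ³)`, in the momentum representation -/

/-- Momentum space `ℝ³`, with the Euclidean norm and Lebesgue measure. -/
abbrev R3 : Type := EuclideanSpace ℝ (Fin 3)

/-- `L²((ℝ³)ⁿ)`: wave functions of `n` distinguishable phonons. -/
abbrev L2n (n : ℕ) : Type := Lp ℂ 2 (volume : Measure (Fin n → R3))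

theorem measurePreserving_perm (n : ℕ) (σ : Equiv.Perm (Fin n)) :
    MeasurePreserving (fun K : Fin n → R3 => K ∘ σ) volume volume := by
  have h := volume_measurePreserving_piCongrLeft (fun _ : Fin n => R3) σ.symm
  have e : (MeasurableEquiv.piCongrLeft (fun _ : Fin n => R3) σ.symm : (Fin n → R3) → Fin n → R3)
      = fun K => K ∘ σ := by
    funext K i
    simpa using MeasurableEquiv.piCongrLeft_apply_apply (β := fun _ : Fin n => R3) σ.symm K (σ i)
  rwa [e] at h

/-- The `n`-phonon space: the elements of `L²((ℝ³)ⁿ)` that are invariant under all permutations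
of the `n` momenta. -/
def symL2 (n : ℕ) : Submodule ℂ (L2n n) where
  carrier := {f | ∀ σ : Equiv.Perm (Fin n), (fun K => f (K ∘ σ)) =ᵐ[volume] f}
  zero_mem' := fun σ => by
    have h := Lp.coeFn_zero ℂ 2 (volume : Measure (Fin n → R3))
    have h' := (measurePreserving_perm n σ).quasiMeasurePreserving.ae_eq_comp h
    filter_upwards [h, h'] with K h1 h2
    simp only [Function.comp_apply] at h2
    rw [h1, h2]
    rfl
  add_mem' := fun {f g} hf hg σ => by
    have h := Lp.coeFn_add f g
    have h' := (measurePreserving_perm n σ).quasiMeasurePreserving.ae_eq_comp h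
    filter_upwards [h, h', hf σ, hg σ] with K h1 h2 h3 h4
    simp only [Function.comp_apply, Pi.add_apply] at h1 h2 h3 h4 ⊢
    rw [h1, h2, h3, h4]
  smul_mem' := fun c f hf σ => by
    have h := Lp.coeFn_smul c f
    have h' := (measurePreserving_perm n σ).quasiMeasurePreserving.ae_eq_comp h
    filter_upwards [h, h', hf σ] with K h1 h2 h3
    simp only [Function.comp_apply, Pi.smul_apply] at h1 h2 h3 ⊢
    rw [h1, h2, h3]

theorem isClosed_symL2 (n : ℕ) : IsClosed (symL2 n : Set (L2n n)) := by
  have h : (symL2 n : Set (L2n n)) = ⋂ σ : Equiv.Perm (Fin n),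
      {f | Lp.compMeasurePreserving _ (measurePreserving_perm n σ) f = f} := by
    ext f
    simp only [Set.mem_iInter]
    refine forall_congr' fun σ => ?_
    have h1 := Lp.coeFn_compMeasurePreserving f (measurePreserving_perm n σ)
    constructor
    · intro h
      exact Lp.ext (h1.trans h)
    · intro h
      have h2 : Lp.compMeasurePreserving _ (measurePreserving_perm n σ) f = f := h
      rw [h2] at h1
      exact h1.symm
  rw [h]
  exact isClosed_iInter fun σ => isClosed_eq
    (Lp.isometry_compMeasurePreserving (measurePreserving_perm n σ)).continuous continuous_id

instance completeSpace_symL2 (n : ℕ) : CompleteSpace (symL2 n) :=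
  (isClosed_symL2 n).completeSpace_coe

/-- The bosonic Fock space `⨁ₙ L²_sym((ℝ³)ⁿ)` (Hilbert space direct sum). -/
abbrev Fock : Type := lp (fun n : ℕ => symL2 n) 2

/-- The `n`-phonon wave function of `Ψ` (a function defined up to null sets). -/
def sector (Ψ : Fock) (n : ℕ) : (Fin n → R3) → ℂ := ((Ψ n : symL2 n) : L2n n)

theorem sector_zero (n : ℕ) : sector 0 n =ᵐ[volume] 0 := Lp.coeFn_zero _ _ _

theorem sector_add (Ψ Φ : Fock) (n : ℕ) :
    sector (Ψ + Φ) n =ᵐ[volume] sector Ψ n + sector Φ n := Lp.coeFn_add _ _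

theorem sector_smul (c : ℂ) (Ψ : Fock) (n : ℕ) :
    sector (c • Ψ) n =ᵐ[volume] c • sector Ψ n := Lp.coeFn_smul _ _

theorem Fock.ext_sector {Ψ Φ : Fock} (h : ∀ n, sector Ψ n =ᵐ[volume] sector Φ n) : Ψ = Φ :=
  lp.ext (funext fun n => Subtype.ext (Lp.ext (h n)))

/-! ### Annihilation and creation operators, sector by sector -/

/-- The integral defining `a(f)ψ` converges for almost every value of the remaining momenta. -/
def AnnihConverges (f : R3 → ℂ) (n : ℕ) (ψ : (Fin (n + 1) → R3) → ℂ) : Prop :=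
  ∀ᵐ K : Fin n → R3, Integrable fun k : R3 => conj (f k) * ψ (Fin.cons k K)

/-- `(a(f)ψ)(k₁,…,kₙ) = √(n+1) ∫ conj f(k) ψ(k,k₁,…,kₙ) dk`, from `n+1` phonons to `n`. -/
def annih (f : R3 → ℂ) (n : ℕ) (ψ : (Fin (n + 1) → R3) → ℂ) : (Fin n → R3) → ℂ :=
  fun K => (Real.sqrt (n + 1) : ℂ) * ∫ k : R3, conj (f k) * ψ (Fin.cons k K)

/-- `(a*(f)ψ)(k₁,…,kₙ₊₁) = (n+1)^{-1/2} ∑ⱼ f(kⱼ) ψ(k₁,…,kⱼ₋₁,kⱼ₊₁,…,kₙ₊₁)`, from `n` phonons to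
`n+1`. -/
def creat (f : R3 → ℂ) (n : ℕ) (ψ : (Fin n → R3) → ℂ) : (Fin (n + 1) → R3) → ℂ :=
  fun K => ((Real.sqrt (n + 1) : ℂ))⁻¹ * ∑ j : Fin (n + 1), f (K j) * ψ (j.removeNth K)

/-- The `n`-phonon component of `a*(f)Ψ`; it vanishes for `n = 0`. -/
def creatSector (f : R3 → ℂ) (Ψ : Fock) : (n : ℕ) → (Fin n → R3) → ℂ
  | 0 => 0
  | n + 1 => creat f n (sector Ψ n)

/-! ### The model -/

/-- The symbol of `H₀ = (P - P_f)² + N + 1` on the `n`-phonon sector: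
`(P - (k₁ + ⋯ + kₙ))² + n + 1`. -/
def freeSymbol (P : R3) (n : ℕ) (K : Fin n → R3) : ℝ := ‖P - ∑ j, K j‖ ^ 2 + n + 1

/-- The maximal domain of the operator acting on each sector as multiplication by `w n`. -/
def mulDomain (w : (n : ℕ) → (Fin n → R3) → ℝ) : Submodule ℂ Fock where
  carrier := {Ψ | ∃ η : Fock, ∀ n, sector η n =ᵐ[volume] fun K => (w n K : ℂ) * sector Ψ n K}
  zero_mem' := ⟨0, fun n => by
    filter_upwards [sector_zero n] with K h
    simp [h]⟩
  add_mem' := fun {Ψ Φ} ⟨η, hη⟩ ⟨θ, hθ⟩ => ⟨η + θ, fun n => by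
    filter_upwards [sector_add Ψ Φ n, sector_add η θ n, hη n, hθ n] with K h1 h2 h3 h4
    rw [h2, Pi.add_apply, h3, h4, h1, Pi.add_apply]
    ring⟩
  smul_mem' := fun c Ψ ⟨η, hη⟩ => ⟨c • η, fun n => by
    filter_upwards [sector_smul c Ψ n, sector_smul c η n, hη n] with K h1 h2 h3
    rw [h2, Pi.smul_apply, h3, h1, Pi.smul_apply, smul_eq_mul, smul_eq_mul]
    ring⟩

/-- The operator domain `D(H₀)`. -/
def freeDomain (P : R3) : Submodule ℂ Fock := mulDomain (freeSymbol P)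

/-- The form domain `D(H₀^{1/2})`. -/
def formDomain (P : R3) : Submodule ℂ Fock := mulDomain fun n K => Real.sqrt (freeSymbol P n K)

/-- The form factor `v̂(k) = 1 / (4π|k|)` of the Fröhlich polaron. -/
def vHat (k : R3) : ℂ := ((1 / (4 * Real.pi * ‖k‖) : ℝ) : ℂ)

/-- The form factor with ultraviolet cutoff, `v̂_Λ(k) = v̂(k) χ_{[0,Λ)}(|k|)`. -/
def vHatCut (Λ : ℝ) (k : R3) : ℂ := {k : R3 | ‖k‖ < Λ}.indicator vHat k

/-! ### Respecting null sets -/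

theorem ae_cons {n : ℕ} {p : (Fin (n + 1) → R3) → Prop} (h : ∀ᵐ x, p x) :
    ∀ᵐ K : Fin n → R3, ∀ᵐ k : R3, p (Fin.cons k K) := by
  have h1 := (volume_preserving_piFinSuccAbove (fun _ : Fin (n + 1) => R3) 0).symm
  have h2 : ∀ᵐ y : R3 × (Fin n → R3), p (Fin.cons y.1 y.2) := by
    have := h1.quasiMeasurePreserving.ae h
    simpa [MeasurableEquiv.piFinSuccAbove, Fin.insertNthEquiv, Fin.insertNth_zero'] using this
  have h3 := Measure.measurePreserving_swap (μ := (volume : Measure (Fin n → R3)))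
    (ν := (volume : Measure R3)) |>.quasiMeasurePreserving.ae h2
  exact Measure.ae_ae_of_ae_prod h3

theorem ae_removeNth {n : ℕ} {p : (Fin n → R3) → Prop} (h : ∀ᵐ K, p K) (j : Fin (n + 1)) :
    ∀ᵐ x : Fin (n + 1) → R3, p (j.removeNth x) := by
  have h1 := (volume_preserving_piFinSuccAbove (fun _ : Fin (n + 1) => R3) j)
  have h2 : ∀ᵐ y : R3 × (Fin n → R3), p y.2 := Measure.quasiMeasurePreserving_snd.ae h
  exact h1.quasiMeasurePreserving.ae h2

section

variable {f : R3 → ℂ} {n : ℕ}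

theorem annihConverges_congr {φ ψ : (Fin (n + 1) → R3) → ℂ} (h : φ =ᵐ[volume] ψ)
    (hφ : AnnihConverges f n φ) : AnnihConverges f n ψ := by
  filter_upwards [ae_cons h, hφ] with K h1 h2
  refine h2.congr ?_
  filter_upwards [h1] with k hk
  rw [hk]

theorem annih_congr {φ ψ : (Fin (n + 1) → R3) → ℂ} (h : φ =ᵐ[volume] ψ) :
    annih f n φ =ᵐ[volume] annih f n ψ := by
  filter_upwards [ae_cons h] with K h1
  unfold annih
  congr 1
  refine integral_congr_ae ?_
  filter_upwards [h1] with k hk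
  rw [hk]

theorem annihConverges_zero : AnnihConverges f n 0 := by
  refine Eventually.of_forall fun K => ?_
  simp

theorem annih_zero : annih f n 0 = 0 := by
  funext K
  simp [annih]

theorem AnnihConverges.add {φ ψ : (Fin (n + 1) → R3) → ℂ} (hφ : AnnihConverges f n φ)
    (hψ : AnnihConverges f n ψ) : AnnihConverges f n (φ + ψ) := by
  filter_upwards [hφ, hψ] with K h1 h2
  refine (h1.add h2).congr (Eventually.of_forall fun k => ?_)
  simp only [Pi.add_apply, mul_add]

theorem AnnihConverges.annih_add {φ ψ : (Fin (n + 1) → R3) → ℂ} (hφ : AnnihConverges f n φ)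
    (hψ : AnnihConverges f n ψ) :
    annih f n (φ + ψ) =ᵐ[volume] annih f n φ + annih f n ψ := by
  filter_upwards [hφ, hψ] with K h1 h2
  simp only [annih, Pi.add_apply, mul_add]
  rw [integral_add h1 h2, mul_add]

theorem AnnihConverges.smul {φ : (Fin (n + 1) → R3) → ℂ} (c : ℂ) (hφ : AnnihConverges f n φ) :
    AnnihConverges f n (c • φ) := by
  filter_upwards [hφ] with K h1
  refine (h1.const_mul c).congr (Eventually.of_forall fun k => ?_)
  simp only [Pi.smul_apply, smul_eq_mul]
  ring

theorem annih_smul (c : ℂ) (φ : (Fin (n + 1) → R3) → ℂ) :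
    annih f n (c • φ) = c • annih f n φ := by
  funext K
  simp only [annih, Pi.smul_apply, smul_eq_mul]
  rw [mul_left_comm, ← integral_const_mul (r := c)]
  congr 2
  funext k
  ring

theorem creat_congr {φ ψ : (Fin n → R3) → ℂ} (h : φ =ᵐ[volume] ψ) :
    creat f n φ =ᵐ[volume] creat f n ψ := by
  have h1 : ∀ᵐ x : Fin (n + 1) → R3, ∀ j : Fin (n + 1),
      φ (j.removeNth x) = ψ (j.removeNth x) := ae_all_iff.2 fun j => ae_removeNth h j
  filter_upwards [h1] with x hx
  simp only [creat, hx]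

theorem creatSector_zero (f : R3 → ℂ) (n : ℕ) : creatSector f 0 n =ᵐ[volume] 0 := by
  cases n with
  | zero => exact EventuallyEq.rfl
  | succ n =>
    refine (creat_congr (sector_zero n)).trans (Eventually.of_forall fun K => ?_)
    simp [creat]

theorem creatSector_add (f : R3 → ℂ) (Ψ Φ : Fock) (n : ℕ) :
    creatSector f (Ψ + Φ) n =ᵐ[volume] creatSector f Ψ n + creatSector f Φ n := by
  cases n with
  | zero => simp [creatSector]
  | succ n =>
    refine (creat_congr (sector_add Ψ Φ n)).trans (Eventually.of_forall fun K => ?_)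
    simp [creatSector, creat, mul_add, Finset.sum_add_distrib]

theorem creatSector_smul (f : R3 → ℂ) (c : ℂ) (Ψ : Fock) (n : ℕ) :
    creatSector f (c • Ψ) n =ᵐ[volume] c • creatSector f Ψ n := by
  cases n with
  | zero => simp [creatSector]
  | succ n =>
    refine (creat_congr (sector_smul c Ψ n)).trans (Eventually.of_forall fun K => ?_)
    simp only [creatSector, creat, Pi.smul_apply, smul_eq_mul, mul_left_comm _ c,
      ← Finset.mul_sum]

end

/-! ### The Hamiltonian with cutoff, as an operator on `D(H₀)` -/

/-- `(Ψ, η)` belongs to the graph of `(P - P_f)² + N + √α (a(f) + a*(f))`: `Ψ ∈ D(H₀)`, and `η` is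
the Fock space vector obtained by applying this expression to `Ψ` sector by sector. -/
def cutoffGraph (α : ℝ) (f : R3 → ℂ) (P : R3) : Submodule ℂ (Fock × Fock) where
  carrier := {x | x.1 ∈ freeDomain P ∧
    (∀ n, AnnihConverges f n (sector x.1 (n + 1))) ∧
    ∀ n, sector x.2 n =ᵐ[volume] fun K =>
      ((freeSymbol P n K - 1 : ℝ) : ℂ) * sector x.1 n K +
        (Real.sqrt α : ℂ) * (annih f n (sector x.1 (n + 1)) K + creatSector f x.1 n K)}
  zero_mem' := by
    refine ⟨Submodule.zero_mem _, fun n => annihConverges_congr (sector_zero _).symm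
      annihConverges_zero, fun n => ?_⟩
    filter_upwards [sector_zero n, creatSector_zero f n,
      annih_congr (f := f) (sector_zero (n + 1))] with K h1 h2 h3
    simp only [Prod.fst_zero, Prod.snd_zero]
    rw [h1, h2, h3, annih_zero]
    simp
  add_mem' := by
    rintro ⟨Ψ, η⟩ ⟨Φ, θ⟩ ⟨hΨ, cΨ, eΨ⟩ ⟨hΦ, cΦ, eΦ⟩
    refine ⟨Submodule.add_mem _ hΨ hΦ, fun n => annihConverges_congr (sector_add _ _ _).symm
      ((cΨ n).add (cΦ n)), fun n => ?_⟩
    filter_upwards [sector_add Ψ Φ n, sector_add η θ n, creatSector_add f Ψ Φ n,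
      annih_congr (f := f) (sector_add Ψ Φ (n + 1)), (cΨ n).annih_add (cΦ n), eΨ n, eΦ n]
      with K h1 h2 h3 h4 h5 h6 h7
    simp only [Prod.mk_add_mk, Pi.add_apply] at h1 h2 h3 h4 h5 h6 h7 ⊢
    rw [h1, h2, h3, h4, h5, h6, h7]
    ring
  smul_mem' := by
    rintro c ⟨Ψ, η⟩ ⟨hΨ, cΨ, eΨ⟩
    refine ⟨Submodule.smul_mem _ c hΨ, fun n => annihConverges_congr (sector_smul _ _ _).symm
      ((cΨ n).smul c), fun n => ?_⟩
    filter_upwards [sector_smul c Ψ n, sector_smul c η n, creatSector_smul f c Ψ n,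
      annih_congr (f := f) (sector_smul c Ψ (n + 1)), eΨ n] with K h1 h2 h3 h4 h5
    rw [annih_smul] at h4
    simp only [Prod.smul_mk, Pi.smul_apply, smul_eq_mul] at h1 h2 h3 h4 h5 ⊢
    rw [h1, h2, h3, h4, h5]
    ring

/-- The graph is single-valued. -/
theorem cutoffGraph_functional (α : ℝ) (f : R3 → ℂ) (P : R3) (x : Fock × Fock)
    (hx : x ∈ cutoffGraph α f P) (h0 : x.1 = 0) : x.2 = 0 := by
  obtain ⟨Ψ, η⟩ := x
  obtain rfl : Ψ = 0 := h0
  refine Fock.ext_sector fun n => ?_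
  filter_upwards [hx.2.2 n, sector_zero n, creatSector_zero f n,
    annih_congr (f := f) (sector_zero (n + 1))] with K h h1 h2 h3
  rw [h, h1, h2, h3, annih_zero]
  simp

/-- The fiber Hamiltonian with cutoff, `H_Λ(P) = (P - P_f)² + N + √α φ(v_Λ)`, acting on those
`Ψ ∈ D(H₀)` for which the expression defines a vector of Fock space. -/
def cutoffHamiltonian (α Λ : ℝ) (P : R3) : Fock →ₗ.[ℂ] Fock :=
  (cutoffGraph α (vHatCut Λ) P).toLinearPMap

theorem cutoffHamiltonian_graph (α Λ : ℝ) (P : R3) :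
    (cutoffHamiltonian α Λ P).graph = cutoffGraph α (vHatCut Λ) P :=
  Submodule.toLinearPMap_graph_eq _ (cutoffGraph_functional α _ P)

/-! ### The Hamiltonian without cutoff, through its quadratic form -/

/-- The integrand of `⟨φ, a(f)ψ⟩` for `φ` with `n` and `ψ` with `n + 1` phonons, as a function of the
`n + 1` momenta (up to the factor `√(n+1)`). -/
def annihKernel (f : R3 → ℂ) {n : ℕ} (φ : (Fin n → R3) → ℂ) (ψ : (Fin (n + 1) → R3) → ℂ) :
    (Fin (n + 1) → R3) → ℂ :=
  fun K => conj (φ (Fin.tail K)) * (conj (f (K 0)) * ψ K)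

/-- `⟨φ, a(f)ψ⟩ = √(n+1) ∫ conj φ(k₁,…,kₙ) conj f(k) ψ(k,k₁,…,kₙ) dk dk₁ ⋯ dkₙ`. -/
def annihForm (f : R3 → ℂ) {n : ℕ} (φ : (Fin n → R3) → ℂ) (ψ : (Fin (n + 1) → R3) → ℂ) : ℂ :=
  (Real.sqrt (n + 1) : ℂ) * ∫ K, annihKernel f φ ψ K

/-- The integrand of `⟨φ, H₀ψ⟩` on the `n`-phonon sector. -/
def freeKernel (P : R3) {n : ℕ} (φ ψ : (Fin n → R3) → ℂ) : (Fin n → R3) → ℂ :=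
  fun K => conj (φ K) * ((freeSymbol P n K : ℂ) * ψ K)

/-- The `n`-th term of the sesquilinear form
`⟨Φ, ((P - P_f)² + N + 1)Ψ⟩ + √α (⟨Φ, a(v)Ψ⟩ + conj ⟨Ψ, a(v)Φ⟩)`. -/
def formTerm (α : ℝ) (P : R3) (Φ Ψ : Fock) (n : ℕ) : ℂ :=
  (∫ K, freeKernel P (sector Φ n) (sector Ψ n) K) +
    (Real.sqrt α : ℂ) * (annihForm vHat (sector Φ n) (sector Ψ (n + 1)) +
      conj (annihForm vHat (sector Ψ n) (sector Φ (n + 1))))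

/-- All integrals in `formTerm α P Φ Ψ n` converge (as Lebesgue integrals). -/
def FormTermConverges (P : R3) (Φ Ψ : Fock) (n : ℕ) : Prop :=
  Integrable (freeKernel P (sector Φ n) (sector Ψ n)) ∧
    Integrable (annihKernel vHat (sector Φ n) (sector Ψ (n + 1))) ∧
    Integrable (annihKernel vHat (sector Ψ n) (sector Φ (n + 1)))

/-- The sesquilinear form `Q_P(Φ, Ψ)`, whose diagonal is
`Q_P(Ψ) = ⟨Ψ, ((P - P_f)² + N + 1)Ψ⟩ + 2√α Re ⟨Ψ, a(v)Ψ⟩`, converges and has the value `c`. -/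
def HasForm (α : ℝ) (P : R3) (Φ Ψ : Fock) (c : ℂ) : Prop :=
  (∀ n, FormTermConverges P Φ Ψ n) ∧ HasSum (formTerm α P Φ Ψ) c

section

variable {P : R3} {Φ : Fock} {n : ℕ}

theorem ae_tail {p : (Fin n → R3) → Prop} (h : ∀ᵐ K, p K) :
    ∀ᵐ x : Fin (n + 1) → R3, p (Fin.tail x) := by
  have := ae_removeNth h 0
  simpa only [Fin.removeNth_zero] using this

theorem freeKernel_zero_ae : freeKernel P (sector Φ n) (sector 0 n) =ᵐ[volume] 0 := by
  filter_upwards [sector_zero n] with K h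
  simp [freeKernel, h]

theorem annihKernel_zero_ae (φ : (Fin n → R3) → ℂ) :
    annihKernel vHat φ (sector 0 (n + 1)) =ᵐ[volume] 0 := by
  filter_upwards [sector_zero (n + 1)] with K h
  simp [annihKernel, h]

theorem annihKernel_zero_ae' (ψ : (Fin (n + 1) → R3) → ℂ) :
    annihKernel vHat (sector 0 n) ψ =ᵐ[volume] 0 := by
  filter_upwards [ae_tail (sector_zero n)] with K h
  simp [annihKernel, h]

theorem freeKernel_add_ae (Ψ Θ : Fock) : freeKernel P (sector Φ n) (sector (Ψ + Θ) n) =ᵐ[volume]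
    freeKernel P (sector Φ n) (sector Ψ n) + freeKernel P (sector Φ n) (sector Θ n) := by
  filter_upwards [sector_add Ψ Θ n] with K h
  simp only [freeKernel, h, Pi.add_apply]
  ring

theorem annihKernel_add_ae (φ : (Fin n → R3) → ℂ) (Ψ Θ : Fock) :
    annihKernel vHat φ (sector (Ψ + Θ) (n + 1)) =ᵐ[volume]
      annihKernel vHat φ (sector Ψ (n + 1)) + annihKernel vHat φ (sector Θ (n + 1)) := by
  filter_upwards [sector_add Ψ Θ (n + 1)] with K h
  simp only [annihKernel, h, Pi.add_apply]
  ring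

theorem annihKernel_add_ae' (Ψ Θ : Fock) (ψ : (Fin (n + 1) → R3) → ℂ) :
    annihKernel vHat (sector (Ψ + Θ) n) ψ =ᵐ[volume]
      annihKernel vHat (sector Ψ n) ψ + annihKernel vHat (sector Θ n) ψ := by
  filter_upwards [ae_tail (sector_add Ψ Θ n)] with K h
  simp only [annihKernel, h, Pi.add_apply, map_add]
  ring

theorem freeKernel_smul_ae (c : ℂ) (Ψ : Fock) :
    freeKernel P (sector Φ n) (sector (c • Ψ) n) =ᵐ[volume]
      c • freeKernel P (sector Φ n) (sector Ψ n) := by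
  filter_upwards [sector_smul c Ψ n] with K h
  simp only [freeKernel, h, Pi.smul_apply, smul_eq_mul]
  ring

theorem annihKernel_smul_ae (φ : (Fin n → R3) → ℂ) (c : ℂ) (Ψ : Fock) :
    annihKernel vHat φ (sector (c • Ψ) (n + 1)) =ᵐ[volume]
      c • annihKernel vHat φ (sector Ψ (n + 1)) := by
  filter_upwards [sector_smul c Ψ (n + 1)] with K h
  simp only [annihKernel, h, Pi.smul_apply, smul_eq_mul]
  ring

theorem annihKernel_smul_ae' (c : ℂ) (Ψ : Fock) (ψ : (Fin (n + 1) → R3) → ℂ) :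
    annihKernel vHat (sector (c • Ψ) n) ψ =ᵐ[volume]
      conj c • annihKernel vHat (sector Ψ n) ψ := by
  filter_upwards [ae_tail (sector_smul c Ψ n)] with K h
  simp only [annihKernel, h, Pi.smul_apply, smul_eq_mul, map_mul]
  ring

theorem formTerm_zero (α : ℝ) : formTerm α P Φ 0 n = 0 := by
  simp only [formTerm, annihForm, integral_congr_ae freeKernel_zero_ae,
    integral_congr_ae (annihKernel_zero_ae _), integral_congr_ae (annihKernel_zero_ae' _)]
  simp

theorem HasForm.zero_right (α : ℝ) (P : R3) (Φ : Fock) : HasForm α P Φ 0 0 := by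
  refine ⟨fun n => ⟨(integrable_zero _ _ _).congr freeKernel_zero_ae.symm,
    (integrable_zero _ _ _).congr (annihKernel_zero_ae _).symm,
    (integrable_zero _ _ _).congr (annihKernel_zero_ae' _).symm⟩, ?_⟩
  have : formTerm α P Φ 0 = fun _ => 0 := funext fun n => formTerm_zero α
  rw [this]
  exact hasSum_zero

theorem HasForm.add_right {α : ℝ} {Ψ Θ : Fock} {c d : ℂ} (h : HasForm α P Φ Ψ c)
    (h' : HasForm α P Φ Θ d) : HasForm α P Φ (Ψ + Θ) (c + d) := by
  refine ⟨fun n => ?_, ?_⟩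
  · obtain ⟨h1, h2, h3⟩ := h.1 n
    obtain ⟨k1, k2, k3⟩ := h'.1 n
    exact ⟨(h1.add k1).congr (freeKernel_add_ae _ _).symm,
      (h2.add k2).congr (annihKernel_add_ae _ _ _).symm,
      (h3.add k3).congr (annihKernel_add_ae' _ _ _).symm⟩
  · have e : formTerm α P Φ (Ψ + Θ) = fun n => formTerm α P Φ Ψ n + formTerm α P Φ Θ n := by
      funext n
      obtain ⟨h1, h2, h3⟩ := h.1 n
      obtain ⟨k1, k2, k3⟩ := h'.1 n
      simp only [formTerm, annihForm, integral_congr_ae (freeKernel_add_ae _ _),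
        integral_congr_ae (annihKernel_add_ae _ _ _),
        integral_congr_ae (annihKernel_add_ae' _ _ _)]
      rw [integral_add' h1 k1, integral_add' h2 k2, integral_add' h3 k3]
      simp only [map_mul, map_add]
      ring
    rw [e]
    exact h.2.add h'.2

theorem HasForm.smul_right {α : ℝ} {Ψ : Fock} {c : ℂ} (a : ℂ) (h : HasForm α P Φ Ψ c) :
    HasForm α P Φ (a • Ψ) (a * c) := by
  refine ⟨fun n => ?_, ?_⟩
  · obtain ⟨h1, h2, h3⟩ := h.1 n
    exact ⟨(h1.smul a).congr (freeKernel_smul_ae _ _).symm,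
      (h2.smul a).congr (annihKernel_smul_ae _ _ _).symm,
      (h3.smul (conj a)).congr (annihKernel_smul_ae' _ _ _).symm⟩
  · have e : formTerm α P Φ (a • Ψ) = fun n => a * formTerm α P Φ Ψ n := by
      funext n
      simp only [formTerm, annihForm, integral_congr_ae (freeKernel_smul_ae _ _),
        integral_congr_ae (annihKernel_smul_ae _ _ _),
        integral_congr_ae (annihKernel_smul_ae' _ _ _), Pi.smul_apply, smul_eq_mul,
        integral_const_mul, map_mul, Complex.conj_conj]
      ring
    rw [e]
    exact h.2.mul_left a

end

/-- `(Ψ, η)` belongs to the graph of the operator associated with the form: `Ψ ∈ D(H₀^{1/2})` and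
`Q_P(Φ, Ψ) = ⟨Φ, η + Ψ⟩` for all `Φ ∈ D(H₀^{1/2})`; the shift by `Ψ` appears because `Q_P` is the
form of `H(P) + 1`. -/
def fiberGraph (α : ℝ) (P : R3) : Submodule ℂ (Fock × Fock) where
  carrier := {x | x.1 ∈ formDomain P ∧
    ∀ Φ ∈ formDomain P, HasForm α P Φ x.1 (inner ℂ Φ (x.2 + x.1))}
  zero_mem' := by
    refine ⟨Submodule.zero_mem _, fun Φ _ => ?_⟩
    simpa using HasForm.zero_right α P Φ
  add_mem' := by
    rintro ⟨Ψ, η⟩ ⟨Θ, θ⟩ ⟨hΨ, eΨ⟩ ⟨hΘ, eΘ⟩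
    refine ⟨Submodule.add_mem _ hΨ hΘ, fun Φ hΦ => ?_⟩
    have h := (eΨ Φ hΦ).add_right (eΘ Φ hΦ)
    rw [← inner_add_right, add_add_add_comm] at h
    exact h
  smul_mem' := by
    rintro c ⟨Ψ, η⟩ ⟨hΨ, eΨ⟩
    refine ⟨Submodule.smul_mem _ c hΨ, fun Φ hΦ => ?_⟩
    have h := (eΨ Φ hΦ).smul_right c
    rw [← inner_smul_right, smul_add] at h
    exact h

theorem one_le_freeSymbol (P : R3) (n : ℕ) (K : Fin n → R3) : 1 ≤ freeSymbol P n K := by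
  unfold freeSymbol
  have : (0 : ℝ) ≤ n := n.cast_nonneg
  nlinarith [sq_nonneg ‖P - ∑ j, K j‖]

theorem continuous_freeSymbol (P : R3) (n : ℕ) : Continuous (freeSymbol P n) := by
  unfold freeSymbol
  fun_prop

theorem freeSymbol_perm (P : R3) (n : ℕ) (K : Fin n → R3) (σ : Equiv.Perm (Fin n)) :
    freeSymbol P n (K ∘ σ) = freeSymbol P n K := by
  unfold freeSymbol
  simp only [Function.comp_apply, Equiv.sum_comp σ K]

/-- The form domain is dense: only `0` is orthogonal to it. -/
theorem eq_zero_of_orthogonal_formDomain (P : R3) (η : Fock)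
    (h : ∀ Φ ∈ formDomain P, inner ℂ Φ η = 0) : η = 0 := by
  refine Fock.ext_sector fun n => ?_
  refine EventuallyEq.trans ?_ (sector_zero n).symm
  set w : (Fin n → R3) → ℝ := fun K => Real.sqrt (freeSymbol P n K) with hw
  have hw1 : ∀ K, 1 ≤ w K := fun K => Real.one_le_sqrt.2 (one_le_freeSymbol P n K)
  have hwc : Continuous w := (continuous_freeSymbol P n).sqrt
  have hη : MemLp (sector η n) 2 := Lp.memLp _
  have hm : MemLp (fun K => ((w K)⁻¹ : ℂ) * sector η n K) 2 := by
    refine hη.mono ?_ (Eventually.of_forall fun K => ?_)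
    · refine AEStronglyMeasurable.mul ?_ hη.1
      exact (Complex.measurable_ofReal.comp hwc.measurable).inv.aestronglyMeasurable
    · rw [norm_mul, norm_inv, Complex.norm_real, Real.norm_of_nonneg (by linarith [hw1 K])]
      exact mul_le_of_le_one_left (norm_nonneg _) (inv_le_one_of_one_le₀ (hw1 K))
  have hc := hm.coeFn_toLp
  have hs : hm.toLp ∈ symL2 n := fun σ => by
    have h2 := (measurePreserving_perm n σ).quasiMeasurePreserving.ae_eq_comp hc
    filter_upwards [hc, h2, (η n).2 σ] with K h3 h4 h5
    simp only [Function.comp_apply] at h4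
    rw [h4, h3]
    have h6 : sector η n (K ∘ σ) = sector η n K := h5
    rw [h6]
    simp only [hw, freeSymbol_perm]
  have hdom : (lp.single 2 n (⟨hm.toLp, hs⟩ : symL2 n) : Fock) ∈ formDomain P := by
    refine ⟨lp.single 2 n (η n), fun m => ?_⟩
    by_cases hmn : m = n
    · subst hmn
      have e : ∀ a : symL2 m, sector (lp.single 2 m a : Fock) m = (a : L2n m) := fun a => by
        simp only [sector, lp.coeFn_single, Pi.single_eq_same]
      rw [e, e]
      filter_upwards [hc] with K hK
      have h1 : (w K : ℂ) ≠ 0 := by exact_mod_cast (by linarith [hw1 K] : w K ≠ 0)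
      calc sector η m K = (w K : ℂ) * ((w K : ℂ)⁻¹ * sector η m K) := by
            rw [← mul_assoc, mul_inv_cancel₀ h1, one_mul]
        _ = _ := by rw [← hK]
    · have e : ∀ a : symL2 n, sector (lp.single 2 n a : Fock) m =ᵐ[volume] 0 := fun a => by
        simp only [sector, lp.coeFn_single, Pi.single_eq_of_ne hmn]
        exact Lp.coeFn_zero _ _ _
      filter_upwards [e (η n), e ⟨hm.toLp, hs⟩] with K h1 h2
      rw [h1, h2]
      simp
  have h0 := h _ hdom
  rw [lp.inner_single_left, Submodule.coe_inner, L2.inner_def] at h0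
  have h1 : ∫ K, (w K)⁻¹ * ‖sector η n K‖ ^ 2 = 0 := by
    have : ∫ K, (((w K)⁻¹ * ‖sector η n K‖ ^ 2 : ℝ) : ℂ) = 0 := by
      rw [← h0]
      refine integral_congr_ae ?_
      filter_upwards [hc] with K hK
      rw [hK]
      change _ = inner ℂ _ (sector η n K)
      rw [RCLike.inner_apply, map_mul, map_inv₀, Complex.conj_ofReal, mul_left_comm,
        Complex.mul_conj, Complex.normSq_eq_norm_sq]
      push_cast
      ring
    rw [integral_complex_ofReal] at this
    exact_mod_cast this
  have hi : Integrable fun K => (w K)⁻¹ * ‖sector η n K‖ ^ 2 := by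
    refine hη.norm.integrable_sq.mono ?_ (Eventually.of_forall fun K => ?_)
    · exact hwc.measurable.inv.aestronglyMeasurable.mul hη.norm.integrable_sq.1
    · rw [norm_mul, norm_inv, Real.norm_of_nonneg (by linarith [hw1 K] : 0 ≤ w K)]
      exact mul_le_of_le_one_left (norm_nonneg _) (inv_le_one_of_one_le₀ (hw1 K))
  rw [integral_eq_zero_iff_of_nonneg (fun K => mul_nonneg
    (inv_nonneg.2 (by linarith [hw1 K])) (sq_nonneg _)) hi] at h1
  filter_upwards [h1] with K hK
  have h2 : (w K)⁻¹ ≠ 0 := inv_ne_zero (by linarith [hw1 K])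
  simpa [h2] using hK

/-- The graph is single-valued. -/
theorem fiberGraph_functional (α : ℝ) (P : R3) (x : Fock × Fock)
    (hx : x ∈ fiberGraph α P) (h0 : x.1 = 0) : x.2 = 0 := by
  obtain ⟨Ψ, η⟩ := x
  obtain rfl : Ψ = 0 := h0
  refine eq_zero_of_orthogonal_formDomain P η fun Φ hΦ => ?_
  have h := (hx.2 Φ hΦ).2.unique (HasForm.zero_right α P Φ).2
  simpa using h

/-- The fiber Hamiltonian `H(P) = (P - P_f)² + N + √α φ(v)`: the operator such that `H(P) + 1` is
associated with the quadratic form `Q_P` on `D(H₀^{1/2})`. -/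
def fiberHamiltonian (α : ℝ) (P : R3) : Fock →ₗ.[ℂ] Fock := (fiberGraph α P).toLinearPMap

theorem fiberHamiltonian_graph (α : ℝ) (P : R3) :
    (fiberHamiltonian α P).graph = fiberGraph α P :=
  Submodule.toLinearPMap_graph_eq _ (fiberGraph_functional α P)

/-! ### Norm-resolvent convergence -/

/-- `R` is the bounded inverse of `A - z`, i.e. `z` is in the resolvent set of `A` and
`R = (A - z)⁻¹`. -/
def IsResolventAt (A : Fock →ₗ.[ℂ] Fock) (z : ℂ) (R : Fock →L[ℂ] Fock) : Prop :=
  ∀ Ψ Φ : Fock, R Φ = Ψ ↔ ∃ h : Ψ ∈ A.domain, A ⟨Ψ, h⟩ - z • Ψ = Φ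

/-- The operators `A i x` converge along `l` to `B x` in norm-resolvent sense, uniformly in the
parameter `x`: for every non-real `z`, the resolvents `(A i x - z)⁻¹` converge to `(B x - z)⁻¹` in
operator norm, uniformly in `x`. -/
def NormResolventTendstoUniformly {ι X : Type*} (l : Filter ι) (A : ι → X → Fock →ₗ.[ℂ] Fock)
    (B : X → Fock →ₗ.[ℂ] Fock) : Prop :=
  ∀ z : ℂ, z.im ≠ 0 → ∃ (RA : ι → X → Fock →L[ℂ] Fock) (RB : X → Fock →L[ℂ] Fock),
    (∀ᶠ i in l, ∀ x, IsResolventAt (A i x) z (RA i x)) ∧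
    (∀ x, IsResolventAt (B x) z (RB x)) ∧ TendstoUniformly RA RB l

end Polaron

end

/-! Write `T` for `H₀^{-1/2}`, a contraction for every `P`. The form factor is not square integrable
at infinity, so `a*(v̂)` does not act on Fock space, but `U = T a*(v̂) T` is bounded. On passing
from `n` to `n + 1` phonons, the added momentum `k` is the difference of the two values of `P -
P_f`, so one of these is at least `|k|/2`; together with the number operator this pays for `√(n+1)`
and leaves the factor `√2 (1 + |k|²)^{-1/2}` (`coupling_weight_le`). Since `(1 + |k|²)^{-1/2} v̂` is
square integrable (`memLp_weighted_vHat`), `‖U‖` has a bound in which `P` no longer appears.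

Hence the form of `H(P) + 1` is that of `T⁻¹ (1 + B) T⁻¹` with `B = √α (U + U*)` bounded and
self-adjoint (`mem_fiberGraph_iff`), and formally `(H(P) + l)⁻¹ = T (1 + B + (l - 1) T²)⁻¹ T`. With
a cutoff the same holds with some `B_Λ`, and `‖B - B_Λ‖` tends to `0` uniformly in `P` by dominated
convergence.

The coupling need not be small, so `1 + B` need not be positive. But `B_Λ = T C` with `C` bounded,
because `v̂_Λ` is square integrable; by completing a square such a term is absorbed by `(l - 1) T²`
for large `l` (`boundedBelow_pencil`). As `B` is a small perturbation of one fixed `B_{Λ₀}`, a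
single `l` serves for all `P` and all large `Λ`. The factorization `B_Λ = T C` also shows that the
form operator with cutoff is the operator sum on `D(H₀)` (`exists_form_eq_iff`).

An operator with a bounded self-adjoint shifted inverse is self-adjoint, and norm convergence of the
inverses at `-l` passes to every non-real `z` (`norm_resolventOf_sub_le`). -/

namespace Polaron

/-! ### Operators given by a bounded self-adjoint inverse -/

section Abstract

variable {H : Type*} [NormedAddCommGroup H] [InnerProductSpace ℂ H]

/-- `R = (A + l)⁻¹`, expressed through the graph of `A`. -/
def IsShiftedInverse (A : H →ₗ.[ℂ] H) (l : ℝ) (R : H →L[ℂ] H) : Prop :=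
  ∀ Ψ η : H, (Ψ, η) ∈ A.graph ↔ R (η + (l : ℂ) • Ψ) = Ψ

theorem IsShiftedInverse.mem_graph {A : H →ₗ.[ℂ] H} {l : ℝ} {R : H →L[ℂ] H}
    (h : IsShiftedInverse A l R) (x : H) : (R x, x - (l : ℂ) • R x) ∈ A.graph := by
  rw [h, sub_add_cancel]

theorem IsShiftedInverse.eq_zero {A : H →ₗ.[ℂ] H} {l : ℝ} {R : H →L[ℂ] H}
    (h : IsShiftedInverse A l R) {x : H} (hx : R x = 0) : x = 0 := by
  have := h.mem_graph x
  rw [hx, smul_zero, sub_zero] at this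
  exact A.graph_fst_eq_zero_snd this rfl

variable [CompleteSpace H]

/-- The range of `R` lies in the domain. If `x` is orthogonal to it, then `‖R x‖² = ⟨R (R x), x⟩ =
0`, and `R` is injective because `A` is single-valued. -/
theorem IsShiftedInverse.dense_domain {A : H →ₗ.[ℂ] H} {l : ℝ} {R : H →L[ℂ] H}
    (h : IsShiftedInverse A l R) (hR : IsSelfAdjoint R) : Dense (A.domain : Set H) := by
  rw [Submodule.dense_iff_topologicalClosure_eq_top, Submodule.topologicalClosure_eq_top_iff,
    Submodule.eq_bot_iff]
  intro x hx
  refine h.eq_zero (x := x) ?_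
  rw [← inner_self_eq_zero (𝕜 := ℂ)]
  have h1 : R (R x) ∈ A.domain := LinearPMap.mem_domain_of_mem_graph (h.mem_graph (R x))
  have h2 := (Submodule.mem_orthogonal _ _).1 hx _ h1
  rwa [← ContinuousLinearMap.adjoint_inner_right,
    ContinuousLinearMap.isSelfAdjoint_iff'.1 hR] at h2

/-- The graph of `A` consists of the pairs `(R x, x - l R x)`. Pairing such an element with `(y, w)`
yields `⟨x, y - R (w + l y)⟩` (`key`), which vanishes for all `x` exactly when `(y, w)` lies in the
graph of `A`. -/
theorem IsShiftedInverse.isSelfAdjoint {A : H →ₗ.[ℂ] H} {l : ℝ} {R : H →L[ℂ] H}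
    (h : IsShiftedInverse A l R) (hR : IsSelfAdjoint R) : IsSelfAdjoint A := by
  rw [LinearPMap.isSelfAdjoint_def]
  refine LinearPMap.eq_of_eq_graph ?_
  rw [LinearPMap.adjoint_graph_eq_graph_adjoint (h.dense_domain hR)]
  ext ⟨y, w⟩
  have hsymm : ∀ a b, inner ℂ (R a) b = inner ℂ a (R b) := fun a b => by
    rw [← ContinuousLinearMap.adjoint_inner_right, ContinuousLinearMap.isSelfAdjoint_iff'.1 hR]
  have key : ∀ x, inner ℂ (x - (l : ℂ) • R x) y - inner ℂ (R x) w
      = inner ℂ x (y - R (w + (l : ℂ) • y)) := fun x => by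
    rw [inner_sub_left, inner_smul_left, hsymm, hsymm, map_add, map_smul, inner_sub_right,
      inner_add_right, inner_smul_right, Complex.conj_ofReal]
    ring
  rw [h, Submodule.mem_adjoint_iff]
  constructor
  · intro hy
    have h1 := hy _ _ (h.mem_graph (y - R (w + (l : ℂ) • y)))
    rw [key, inner_self_eq_zero, sub_eq_zero] at h1
    exact h1.symm
  · intro hy a b hab
    rw [h] at hab
    have h1 := key (b + (l : ℂ) • a)
    rw [hab, hy, sub_self, inner_zero_right, add_sub_cancel_right] at h1
    exact h1

/-- The bounded operator `(A - z)⁻¹`, where `R = (A + l)⁻¹` and `w = z + l`. -/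
noncomputable def resolventOf (R : H →L[ℂ] H) (w : ℂ) : H →L[ℂ] H := Ring.inverse (1 - w • R) * R

theorem isUnit_one_sub_smul {R : H →L[ℂ] H} (hR : IsSelfAdjoint R) {w : ℂ} (hw : w.im ≠ 0) :
    IsUnit (1 - w • R) := by
  have hw0 : w ≠ 0 := fun h => hw (by simp [h])
  have h1 : w⁻¹ ∉ spectrum ℂ R := fun h => by
    have := hR.im_eq_zero_of_mem_spectrum h
    rw [Complex.inv_im, div_eq_zero_iff, neg_eq_zero] at this
    rcases this with h | h
    · exact hw h
    · exact hw0 (Complex.normSq_eq_zero.1 h)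
  rw [spectrum.notMem_iff] at h1
  have h2 : (1 - w • R) = w • (algebraMap ℂ (H →L[ℂ] H) w⁻¹ - R) := by
    rw [smul_sub, Algebra.algebraMap_eq_smul_one, smul_smul, mul_inv_cancel₀ hw0, one_smul]
  rw [h2]
  exact (h1.smul (Units.mk0 w hw0) : _)

/-- This is the usual bound by `|Im z|⁻¹`, obtained without mentioning `A`: in `⟨u, x⟩ = ⟨R y, y⟩ -
w ‖u‖²` the first term on the right is real, so `|Im w| ‖u‖² ≤ ‖u‖ ‖x‖`. -/
theorem norm_resolventOf_le {R : H →L[ℂ] H} (hR : IsSelfAdjoint R) {w : ℂ} (hw : w.im ≠ 0) :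
    ‖resolventOf R w‖ ≤ |w.im|⁻¹ := by
  have hu := isUnit_one_sub_smul hR hw
  refine ContinuousLinearMap.opNorm_le_bound _ (by positivity) fun x => ?_
  set u := resolventOf R w x with hu'
  have hcomm : (1 - w • R) * resolventOf R w = R := by
    rw [resolventOf, ← mul_assoc, Ring.mul_inverse_cancel _ hu, one_mul]
  have hx : u - w • R u = R x := by
    have := congrArg (fun S : H →L[ℂ] H => S x) hcomm
    simpa using this
  have hsymm : ∀ a b, inner ℂ (R a) b = inner ℂ a (R b) := fun a b => by
    rw [← ContinuousLinearMap.adjoint_inner_right, ContinuousLinearMap.isSelfAdjoint_iff'.1 hR]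
  -- `u = R y` with `y = x + w u`
  set y := x + w • u with hy
  have huy : R y = u := by rw [hy, map_add, map_smul, ← hx, sub_add_cancel]
  have him : (inner ℂ (R y) y : ℂ).im = 0 := by
    have h1 : conj (inner ℂ (R y) y : ℂ) = inner ℂ (R y) y := by
      rw [inner_conj_symm, hsymm]
    exact Complex.conj_eq_iff_im.1 h1
  have h2 : (inner ℂ u x : ℂ) = inner ℂ (R y) y - w * (‖u‖ ^ 2 : ℝ) := by
    rw [huy, hy, inner_add_right, inner_smul_right, inner_self_eq_norm_sq_to_K]
    push_cast
    simp
  have h3 : (inner ℂ u x : ℂ).im = - (w.im * ‖u‖ ^ 2) := by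
    rw [h2, Complex.sub_im, him, Complex.im_mul_ofReal, zero_sub]
  have h4 : |w.im| * ‖u‖ ^ 2 ≤ ‖u‖ * ‖x‖ := by
    calc |w.im| * ‖u‖ ^ 2 = |(inner ℂ u x : ℂ).im| := by
          rw [h3, abs_neg, abs_mul, abs_of_nonneg (sq_nonneg ‖u‖)]
      _ ≤ ‖(inner ℂ u x : ℂ)‖ := Complex.abs_im_le_norm _
      _ ≤ _ := norm_inner_le_norm _ _
  have hw' : 0 < |w.im| := abs_pos.2 hw
  rw [inv_mul_eq_div, le_div_iff₀ hw']
  rcases (norm_nonneg u).eq_or_lt with h | h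
  · rw [← h, zero_mul]; exact norm_nonneg _
  · nlinarith

/-- From `(1 - w R)⁻¹ (1 - w R) = 1` one reads off `(1 - w R)⁻¹ = 1 + w (1 - w R)⁻¹ R`, and the last
product is the resolvent just bounded. -/
theorem norm_inverse_one_sub_smul_le {R : H →L[ℂ] H} (hR : IsSelfAdjoint R) {w : ℂ}
    (hw : w.im ≠ 0) : ‖Ring.inverse (1 - w • R)‖ ≤ 1 + ‖w‖ * |w.im|⁻¹ := by
  have h1 : Ring.inverse (1 - w • R) = 1 + w • resolventOf R w := by
    have h := Ring.inverse_mul_cancel _ (isUnit_one_sub_smul hR hw)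
    rw [mul_sub, mul_one, mul_smul_comm] at h
    rw [resolventOf, ← sub_eq_iff_eq_add]
    exact h
  rw [h1]
  refine (norm_add_le _ _).trans (add_le_add ?_ ?_)
  · exact ContinuousLinearMap.norm_id_le
  · rw [norm_smul]
    exact mul_le_mul_of_nonneg_left (norm_resolventOf_le hR hw) (norm_nonneg _)

/-- Since `S` commutes with `(1 - w S)⁻¹`, the difference of the resolvents equals `(1 - w R)⁻¹ (R -
S) (1 - w S)⁻¹`. The constant depends on `w` only, so uniform convergence at one point carries over
to all non-real points. -/
theorem norm_resolventOf_sub_le {R S : H →L[ℂ] H} (hR : IsSelfAdjoint R) (hS : IsSelfAdjoint S)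
    {w : ℂ} (hw : w.im ≠ 0) :
    ‖resolventOf R w - resolventOf S w‖ ≤ (1 + ‖w‖ * |w.im|⁻¹) ^ 2 * ‖R - S‖ := by
  have hRu := isUnit_one_sub_smul hR hw
  have hSu := isUnit_one_sub_smul hS hw
  have h1 : resolventOf R w - resolventOf S w
      = Ring.inverse (1 - w • R) * (R - S) * Ring.inverse (1 - w • S) := by
    have hc : resolventOf S w = S * Ring.inverse (1 - w • S) := by
      have hUS : S * (1 - w • S) = (1 - w • S) * S := by
        rw [mul_sub, sub_mul, mul_one, one_mul, mul_smul_comm, smul_mul_assoc]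
      calc Ring.inverse (1 - w • S) * S
          = Ring.inverse (1 - w • S) * (S * ((1 - w • S) * Ring.inverse (1 - w • S))) := by
            rw [Ring.mul_inverse_cancel _ hSu, mul_one]
        _ = (Ring.inverse (1 - w • S) * (1 - w • S)) * S * Ring.inverse (1 - w • S) := by
            rw [← mul_assoc S, hUS, mul_assoc, mul_assoc, mul_assoc]
        _ = _ := by rw [Ring.inverse_mul_cancel _ hSu, one_mul]
    have h2 : resolventOf R w = resolventOf R w * ((1 - w • S) * Ring.inverse (1 - w • S)) := by
      rw [Ring.mul_inverse_cancel _ hSu, mul_one]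
    have h3 : resolventOf S w
        = (Ring.inverse (1 - w • R) * (1 - w • R)) * (S * Ring.inverse (1 - w • S)) := by
      rw [Ring.inverse_mul_cancel _ hRu, one_mul, hc]
    rw [h2, h3, resolventOf]
    simp only [mul_assoc, mul_sub, sub_mul, mul_one, one_mul, smul_mul_assoc, mul_smul_comm]
    abel
  rw [h1]
  calc _ ≤ ‖Ring.inverse (1 - w • R)‖ * ‖R - S‖ * ‖Ring.inverse (1 - w • S)‖ :=
        (norm_mul_le _ _).trans (mul_le_mul_of_nonneg_right (norm_mul_le _ _) (norm_nonneg _))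
    _ ≤ (1 + ‖w‖ * |w.im|⁻¹) * ‖R - S‖ * (1 + ‖w‖ * |w.im|⁻¹) := by
        gcongr
        · exact norm_inverse_one_sub_smul_le hR hw
        · exact norm_inverse_one_sub_smul_le hS hw
    _ = _ := by ring

/-- In terms of `R`, the equation `A Ψ - z Ψ = Φ` reads `R (Φ + (z + l) Ψ) = Ψ`, that is `R Φ = (1 -
(z + l) R) Ψ`. -/
theorem IsShiftedInverse.resolventOf_apply_eq_iff {A : H →ₗ.[ℂ] H} {l : ℝ} {R : H →L[ℂ] H}
    (h : IsShiftedInverse A l R) (hR : IsSelfAdjoint R) {z : ℂ} (hz : z.im ≠ 0) (Ψ Φ : H) :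
    resolventOf R (z + l) Φ = Ψ ↔ ∃ hΨ : Ψ ∈ A.domain, A ⟨Ψ, hΨ⟩ - z • Ψ = Φ := by
  have hw : (z + l).im ≠ 0 := by simpa using hz
  have hu := isUnit_one_sub_smul hR hw
  have h1 : (∃ hΨ : Ψ ∈ A.domain, A ⟨Ψ, hΨ⟩ - z • Ψ = Φ) ↔ (Ψ, Φ + z • Ψ) ∈ A.graph := by
    simp only [LinearPMap.mem_graph_iff, Subtype.exists, exists_and_left, exists_eq_left,
      sub_eq_iff_eq_add]
  rw [h1, h, add_assoc, ← add_smul, map_add, map_smul]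
  have h2 : R Φ + (z + l) • R Ψ = Ψ ↔ R Φ = (1 - (z + l) • R) Ψ := by
    rw [← eq_sub_iff_add_eq]
    rfl
  rw [h2, resolventOf]
  constructor
  · rintro rfl
    rw [← mul_apply_eq_comp, ← mul_assoc, Ring.mul_inverse_cancel _ hu, one_mul]
  · intro h3
    rw [mul_apply_eq_comp, h3, ← mul_apply_eq_comp,
      Ring.inverse_mul_cancel _ hu, one_apply_eq_self]

/-! ### Form perturbations `T⁻¹ (1 + B) T⁻¹` -/

/-- `1 + B + (l - 1) T²`, so that formally `T⁻¹ (1 + B) T⁻¹ + (l - 1) = T⁻¹ (pencil T B l) T⁻¹`. -/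
def pencil (T B : H →L[ℂ] H) (l : ℝ) : H →L[ℂ] H := 1 + B + ((l - 1 : ℝ) : ℂ) • (T * T)

/-- The formal inverse of `T⁻¹ (1 + B) T⁻¹ + (l - 1)`. -/
noncomputable def pencilInverse (T B : H →L[ℂ] H) (l : ℝ) : H →L[ℂ] H := T * Ring.inverse (pencil T B l) * T

/-- The operator is bounded below by `c`. -/
def BoundedBelow (G : H →L[ℂ] H) (c : ℝ) : Prop := ∀ x, c * ‖x‖ ^ 2 ≤ (inner ℂ x (G x) : ℂ).re

omit [CompleteSpace H] in
theorem BoundedBelow.norm_le {G : H →L[ℂ] H} {c : ℝ} (h : BoundedBelow G c) (x : H) :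
    c * ‖x‖ ≤ ‖G x‖ := by
  rcases (norm_nonneg x).eq_or_lt with h0 | h0
  · rw [← h0, mul_zero]; exact norm_nonneg _
  · have h1 := (h x).trans ((Complex.re_le_norm _).trans (norm_inner_le_norm x (G x)))
    nlinarith

/-- Coercivity of the form `⟨x, G x⟩` gives invertibility, as in the Lax–Milgram theorem. -/
theorem BoundedBelow.isUnit {G : H →L[ℂ] H} {c : ℝ} (hc : 0 < c) (h : BoundedBelow G c) :
    IsUnit G := by
  refine ContinuousLinearMap.isUnit_of_forall_le_norm_inner_map G (c := ⟨c, hc.le⟩) hc fun x => ?_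
  have h1 := (h x).trans (Complex.re_le_norm _)
  rw [← inner_conj_symm, RCLike.norm_conj, mul_comm]
  exact h1

theorem BoundedBelow.norm_inverse_le {G : H →L[ℂ] H} {c : ℝ} (hc : 0 < c)
    (h : BoundedBelow G c) : ‖Ring.inverse G‖ ≤ c⁻¹ := by
  refine ContinuousLinearMap.opNorm_le_bound _ (by positivity) fun x => ?_
  have h1 := h.norm_le (Ring.inverse G x)
  rw [← mul_apply_eq_comp, Ring.mul_inverse_cancel _ (h.isUnit hc),
    one_apply_eq_self] at h1
  rwa [inv_mul_eq_div, le_div_iff₀ hc, mul_comm]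

variable {T B : H →L[ℂ] H} {l c : ℝ}

theorem isSelfAdjoint_pencil (hT : IsSelfAdjoint T) (hB : IsSelfAdjoint B) (l : ℝ) :
    IsSelfAdjoint (pencil T B l) := by
  refine ((IsSelfAdjoint.one _).add hB).add (IsSelfAdjoint.smul ?_ ?_)
  · exact Complex.conj_ofReal _
  · simpa [sq] using hT.pow 2

theorem isSelfAdjoint_pencilInverse (hT : IsSelfAdjoint T) (hB : IsSelfAdjoint B) (l : ℝ) :
    IsSelfAdjoint (pencilInverse T B l) := by
  have h1 : IsSelfAdjoint (Ring.inverse (pencil T B l)) := by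
    have := isSelfAdjoint_pencil hT hB l
    rw [IsSelfAdjoint, ← Ring.inverse_star, this.star_eq]
  have := h1.conjugate T
  rwa [hT.star_eq] at this

/-- The two pencils share the shift term, so they differ by `B - B'` alone, and `G⁻¹ - G'⁻¹ = G⁻¹
(G' - G) G'⁻¹`. -/
theorem norm_pencilInverse_sub_le {B' : H →L[ℂ] H} (hc : 0 < c) (hT : ‖T‖ ≤ 1)
    (h : BoundedBelow (pencil T B l) c) (h' : BoundedBelow (pencil T B' l) c) :
    ‖pencilInverse T B l - pencilInverse T B' l‖ ≤ (c⁻¹) ^ 2 * ‖B - B'‖ := by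
  set G := pencil T B l with hG
  set G' := pencil T B' l with hG'
  have h1 : Ring.inverse G - Ring.inverse G'
      = Ring.inverse G * (B' - B) * Ring.inverse G' := by
    have e : B' - B = G' - G := by
      rw [hG, hG', pencil, pencil]; abel
    rw [e, Ring.inverse_sub_inverse ⟨fun _ => h'.isUnit hc, fun _ => h.isUnit hc⟩]
  have h2 : pencilInverse T B l - pencilInverse T B' l
      = T * (Ring.inverse G * (B' - B) * Ring.inverse G') * T := by
    rw [← h1, mul_sub, sub_mul]
    rfl
  rw [h2]
  have h3 : ‖Ring.inverse G * (B' - B) * Ring.inverse G'‖ ≤ c⁻¹ * ‖B - B'‖ * c⁻¹ := by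
    rw [norm_sub_rev B B']
    refine (norm_mul_le _ _).trans ?_
    gcongr
    · refine (norm_mul_le _ _).trans ?_
      gcongr
      exact h.norm_inverse_le hc
    · exact h'.norm_inverse_le hc
  calc _ ≤ ‖T‖ * ‖Ring.inverse G * (B' - B) * Ring.inverse G'‖ * ‖T‖ :=
        (norm_mul_le _ _).trans (mul_le_mul_of_nonneg_right (norm_mul_le _ _) (norm_nonneg _))
    _ ≤ 1 * (c⁻¹ * ‖B - B'‖ * c⁻¹) * 1 := by gcongr
    _ = _ := by ring

omit [CompleteSpace H] in
theorem pencil_apply (x : H) :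
    pencil T B l x = x + B x + ((l - 1 : ℝ) : ℂ) • T (T x) := rfl

omit [CompleteSpace H] in
-- With `Ψ = T y`, the equation `y + B y = T (η + Ψ)` is the weak form of `T⁻¹ (1 + B) T⁻¹ Ψ = η +
-- Ψ`. Adding `(l - 1) T Ψ = (l - 1) T² y` to both sides produces the pencil; the shift is `l - 1`
-- because the form already belongs to the operator plus `1`.
theorem eq_pencilInverse_iff (hu : IsUnit (pencil T B l)) (Ψ η : H) :
    pencilInverse T B l (η + (l : ℂ) • Ψ) = Ψ ↔ ∃ y, T y = Ψ ∧ y + B y = T (η + Ψ) := by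
  have hl : ∀ y, T y = Ψ → (y + B y = T (η + Ψ) ↔ pencil T B l y = T (η + (l : ℂ) • Ψ)) := by
    rintro y rfl
    rw [pencil_apply, map_add, map_add, map_smul]
    push_cast
    rw [← sub_eq_zero, ← sub_eq_zero (a := _ + _ + _)]
    exact Eq.congr_left (by module)
  constructor
  · intro h
    refine ⟨Ring.inverse (pencil T B l) (T (η + (l : ℂ) • Ψ)), h, (hl _ h).2 ?_⟩
    exact congrArg (fun S : H →L[ℂ] H => S (T (η + (l : ℂ) • Ψ))) (Ring.mul_inverse_cancel _ hu)
  · rintro ⟨y, hy, h⟩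
    rw [hl y hy] at h
    rw [pencilInverse, mul_apply_eq_comp, mul_apply_eq_comp, ← h,
      ← mul_apply_eq_comp (Ring.inverse _), Ring.inverse_mul_cancel _ hu,
      one_apply_eq_self, hy]

omit [CompleteSpace H] in
-- When `B = T C`, the weak equation reads `y = T (η + Ψ - C y)`. So `y` lies in the range of `T`
-- and `Ψ` in the range of `T²`: a solution in the form sense is automatically one in the operator
-- sense.
theorem exists_form_eq_iff {C : H →L[ℂ] H} (hBC : B = T * C)
    (Ψ η : H) : (∃ y, T y = Ψ ∧ y + B y = T (η + Ψ)) ↔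
      ∃ x, T (T x) = Ψ ∧ η + Ψ = x + C (T x) := by
  have hB : ∀ x, B x = T (C x) := fun x => by rw [hBC]; rfl
  constructor
  · rintro ⟨y, hy, h⟩
    have h1 : T (η + Ψ - C y) = y := by rw [map_sub, ← hB, ← h, add_sub_cancel_right]
    exact ⟨η + Ψ - C y, by rw [h1, hy], by rw [h1, sub_add_cancel]⟩
  · rintro ⟨x, hx, h⟩
    exact ⟨T x, hx, by rw [hB, h, map_add]⟩

/-- A perturbation `T C + E` with small `E` gives a pencil that is bounded below for large `l`. -/
theorem boundedBelow_pencil {C E : H →L[ℂ] H} {M e : ℝ} (hT : IsSelfAdjoint T) (hC : ‖C‖ ≤ M)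
    (hE : ‖E‖ ≤ e) (hBC : B = T * C + E) :
    BoundedBelow (pencil T B (1 + M ^ 2)) (3 / 4 - e) := by
  intro x
  have h1 : (inner ℂ x (T (C x)) : ℂ) = inner ℂ (T x) (C x) := by
    rw [← ContinuousLinearMap.adjoint_inner_left, ContinuousLinearMap.isSelfAdjoint_iff'.1 hT]
  have h1' : (inner ℂ x (T (T x)) : ℂ) = inner ℂ (T x) (T x) := by
    rw [← ContinuousLinearMap.adjoint_inner_left, ContinuousLinearMap.isSelfAdjoint_iff'.1 hT]
  have h2 : (inner ℂ x (pencil T B (1 + M ^ 2) x) : ℂ).re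
      = ‖x‖ ^ 2 + (inner ℂ (T x) (C x) : ℂ).re + (inner ℂ x (E x) : ℂ).re + M ^ 2 * ‖T x‖ ^ 2 := by
    rw [pencil_apply, hBC, add_apply, mul_apply_eq_comp,
      inner_add_right, inner_add_right, inner_add_right, inner_smul_right, h1, h1',
      inner_self_eq_norm_sq_to_K, inner_self_eq_norm_sq_to_K]
    simp only [Complex.add_re, add_sub_cancel_left, Complex.re_ofReal_mul]
    simp only [Complex.coe_algebraMap, ← Complex.ofReal_pow, Complex.ofReal_re]
    ring
  rw [h2]
  have h3 : -(‖T x‖ * (M * ‖x‖)) ≤ (inner ℂ (T x) (C x) : ℂ).re := by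
    have a := (Complex.abs_re_le_norm _).trans (norm_inner_le_norm (𝕜 := ℂ) (T x) (C x))
    have b : ‖C x‖ ≤ M * ‖x‖ := C.le_of_opNorm_le hC x
    have d := mul_le_mul_of_nonneg_left b (norm_nonneg (T x))
    linarith [neg_abs_le (inner ℂ (T x) (C x) : ℂ).re]
  have h4 : -(e * ‖x‖ ^ 2) ≤ (inner ℂ x (E x) : ℂ).re := by
    have a := (Complex.abs_re_le_norm _).trans (norm_inner_le_norm (𝕜 := ℂ) x (E x))
    have b : ‖E x‖ ≤ e * ‖x‖ := E.le_of_opNorm_le hE x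
    have d := mul_le_mul_of_nonneg_left b (norm_nonneg x)
    nlinarith [neg_abs_le (inner ℂ x (E x) : ℂ).re]
  -- The square `(‖x‖/2 - M ‖T x‖)²` absorbs the cross term `M ‖T x‖ ‖x‖` using all of the shift
  -- term `M² ‖T x‖²` and one quarter of `‖x‖²`; this leaves `3/4`.
  nlinarith [sq_nonneg (‖x‖ / 2 - M * ‖T x‖)]

end Abstract

/-! ### Operators between `L²` spaces and on `ℓ²` direct sums -/

open scoped NNReal ENNReal

theorem exists_lp_clm {E : ℕ → Type*} [∀ n, NormedAddCommGroup (E n)]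
    [∀ n, InnerProductSpace ℂ (E n)] (L : ∀ n, lp E 2 →ₗ[ℂ] E n) (C : ℝ) (hC : 0 ≤ C)
    (hL : ∀ Φ, ∃ s ≤ (C * ‖Φ‖) ^ 2, HasSum (fun n => ‖L n Φ‖ ^ 2) s) :
    ∃ T : lp E 2 →L[ℂ] lp E 2, ‖T‖ ≤ C ∧ ∀ Φ n, T Φ n = L n Φ := by
  have hmem : ∀ Φ, Memℓp (fun n => L n Φ) 2 := fun Φ => by
    obtain ⟨s, -, h⟩ := hL Φ
    refine memℓp_gen ?_
    simpa using h.summable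
  let T₀ : lp E 2 →ₗ[ℂ] lp E 2 :=
    { toFun := fun Φ => ⟨fun n => L n Φ, hmem Φ⟩
      map_add' := fun Φ Ψ => lp.ext (funext fun n => map_add (L n) Φ Ψ)
      map_smul' := fun c Φ => lp.ext (funext fun n => map_smul (L n) c Φ) }
  have hb : ∀ Φ, ‖T₀ Φ‖ ≤ C * ‖Φ‖ := fun Φ => by
    obtain ⟨s, hs, h⟩ := hL Φ
    have h1 := lp.hasSum_norm (p := 2) (by norm_num) (T₀ Φ)
    simp only [ENNReal.toReal_ofNat, Real.rpow_ofNat] at h1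
    refine le_of_sq_le_sq ?_ (by positivity)
    rwa [h1.unique h]
  exact ⟨T₀.mkContinuous C hb, T₀.mkContinuous_norm_le hC hb, fun Φ n => rfl⟩

theorem hasSum_norm_sq {E : ℕ → Type*} [∀ n, NormedAddCommGroup (E n)] (Φ : lp E 2) :
    HasSum (fun n => ‖Φ n‖ ^ 2) (‖Φ‖ ^ 2) := by
  have h1 := lp.hasSum_norm (p := 2) (by norm_num) Φ
  simpa only [ENNReal.toReal_ofNat, Real.rpow_ofNat] using h1

theorem exists_lp_diag {E : ℕ → Type*} [∀ n, NormedAddCommGroup (E n)]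
    [∀ n, InnerProductSpace ℂ (E n)] (L : ∀ n, E n →L[ℂ] E n) (C : ℝ) (hC : 0 ≤ C)
    (hL : ∀ n, ‖L n‖ ≤ C) :
    ∃ T : lp E 2 →L[ℂ] lp E 2, ‖T‖ ≤ C ∧ ∀ Φ n, T Φ n = L n (Φ n) := by
  refine exists_lp_clm (fun n => (L n).toLinearMap ∘ₗ lp.evalₗ (𝕜 := ℂ) E 2 n) C hC fun Φ => ?_
  have h1 := (hasSum_norm_sq Φ).mul_left (C ^ 2)
  have hle : ∀ n, ‖L n (Φ n)‖ ^ 2 ≤ C ^ 2 * ‖Φ n‖ ^ 2 := fun n => by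
    rw [← mul_pow]
    exact pow_le_pow_left₀ (norm_nonneg _) ((L n).le_of_opNorm_le (hL n) _) 2
  have h2 := Summable.of_nonneg_of_le (fun n => by positivity) hle h1.summable
  exact ⟨_, (hasSum_le hle h2.hasSum h1).trans_eq (mul_pow _ _ _).symm, h2.hasSum⟩

theorem exists_lp_shift {E : ℕ → Type*} [∀ n, NormedAddCommGroup (E n)]
    [∀ n, InnerProductSpace ℂ (E n)] (L : ∀ n, E n →L[ℂ] E (n + 1)) (C : ℝ) (hC : 0 ≤ C)
    (hL : ∀ n, ‖L n‖ ≤ C) :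
    ∃ T : lp E 2 →L[ℂ] lp E 2, ‖T‖ ≤ C ∧ (∀ Φ, T Φ 0 = 0) ∧ ∀ Φ n, T Φ (n + 1) = L n (Φ n) := by
  let M : ∀ n, lp E 2 →ₗ[ℂ] E n := fun n => Nat.casesOn n 0
    fun n => (L n).toLinearMap ∘ₗ lp.evalₗ (𝕜 := ℂ) E 2 n
  obtain ⟨T, hT, h⟩ := exists_lp_clm M C hC fun Φ => by
    have h1 := (hasSum_norm_sq Φ).mul_left (C ^ 2)
    have hle : ∀ n, ‖L n (Φ n)‖ ^ 2 ≤ C ^ 2 * ‖Φ n‖ ^ 2 := fun n => by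
      rw [← mul_pow]
      exact pow_le_pow_left₀ (norm_nonneg _) ((L n).le_of_opNorm_le (hL n) _) 2
    have h2 := Summable.of_nonneg_of_le (fun n => by positivity) hle h1.summable
    refine ⟨_, (hasSum_le hle h2.hasSum h1).trans_eq (mul_pow _ _ _).symm, ?_⟩
    rw [← hasSum_nat_add_iff' 1]
    simpa [M] using h2.hasSum
  exact ⟨T, hT, fun Φ => h Φ 0, fun Φ n => h Φ (n + 1)⟩

/-- `F` is linear on functions themselves; `hcongr` lets it descend to classes modulo null sets. -/
theorem exists_L2_clm {X Y : Type*} [MeasurableSpace X] [MeasurableSpace Y] {μ : Measure X}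
    {ν : Measure Y} (F : (X → ℂ) →ₗ[ℂ] (Y → ℂ)) (C : ℝ≥0)
    (hcongr : ∀ φ ψ, φ =ᵐ[μ] ψ → F φ =ᵐ[ν] F ψ)
    (hF : ∀ φ, MemLp φ 2 μ → AEStronglyMeasurable (F φ) ν ∧
      eLpNorm (F φ) 2 ν ≤ C * eLpNorm φ 2 μ) :
    ∃ L : Lp ℂ 2 μ →L[ℂ] Lp ℂ 2 ν, ‖L‖ ≤ C ∧ ∀ φ, L φ =ᵐ[ν] F φ := by
  have hmem : ∀ φ : Lp ℂ 2 μ, MemLp (F φ) 2 ν := fun φ =>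
    ⟨(hF φ (Lp.memLp φ)).1, (hF φ (Lp.memLp φ)).2.trans_lt
      (ENNReal.mul_lt_top ENNReal.coe_lt_top (Lp.eLpNorm_lt_top φ))⟩
  let L₀ : Lp ℂ 2 μ →ₗ[ℂ] Lp ℂ 2 ν :=
    { toFun := fun φ => (hmem φ).toLp
      map_add' := fun φ ψ => by
        refine Lp.ext ?_
        filter_upwards [(hmem (φ + ψ)).coeFn_toLp, (hmem φ).coeFn_toLp, (hmem ψ).coeFn_toLp,
          Lp.coeFn_add (hmem φ).toLp (hmem ψ).toLp, hcongr _ _ (Lp.coeFn_add φ ψ)]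
          with K h1 h2 h3 h4 h5
        rw [h1, h4, h5, Pi.add_apply, h2, h3, map_add, Pi.add_apply]
      map_smul' := fun c φ => by
        refine Lp.ext ?_
        filter_upwards [(hmem (c • φ)).coeFn_toLp, (hmem φ).coeFn_toLp,
          Lp.coeFn_smul c (hmem φ).toLp, hcongr _ _ (Lp.coeFn_smul c φ)]
          with K h1 h2 h4 h5
        rw [h1, RingHom.id_apply, h4, h5, Pi.smul_apply, h2, map_smul, Pi.smul_apply] }
  have hb : ∀ φ, ‖L₀ φ‖ ≤ C * ‖φ‖ := fun φ => by
    have h1 : ‖L₀ φ‖ = (eLpNorm (F φ) 2 ν).toReal := Lp.norm_toLp _ (hmem φ)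
    rw [h1, Lp.norm_def, ← ENNReal.coe_toReal, ← ENNReal.toReal_mul]
    exact ENNReal.toReal_mono (ENNReal.mul_lt_top ENNReal.coe_lt_top (Lp.eLpNorm_lt_top φ)).ne
      (hF φ (Lp.memLp φ)).2
  exact ⟨L₀.mkContinuous C hb, L₀.mkContinuous_norm_le C.2 hb, fun φ => (hmem φ).coeFn_toLp⟩

theorem eLpNorm_two_sq {X : Type*} [MeasurableSpace X] (μ : Measure X) (f : X → ℂ) :
    eLpNorm f 2 μ ^ 2 = ∫⁻ x, ‖f x‖ₑ ^ 2 ∂μ := by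
  have := eLpNorm_nnreal_pow_eq_lintegral (μ := μ) (f := f) (p := 2) (by norm_num)
  simpa using this

theorem eLpNorm_prod_mul {X Y : Type*} [MeasurableSpace X] [MeasurableSpace Y] {μ : Measure X}
    {ν : Measure Y} [SFinite μ] [SFinite ν] {g : X → ℂ} {φ : Y → ℂ}
    (hg : AEStronglyMeasurable g μ) (hφ : AEStronglyMeasurable φ ν) :
    eLpNorm (fun y : X × Y => g y.1 * φ y.2) 2 (μ.prod ν) = eLpNorm g 2 μ * eLpNorm φ 2 ν := by
  rw [← ENNReal.pow_right_strictMono (n := 2) two_ne_zero |>.injective.eq_iff, mul_pow]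
  simp only [eLpNorm_two_sq, enorm_mul, mul_pow]
  exact lintegral_prod_mul (hg.enorm.pow_const 2) (hφ.enorm.pow_const 2)

theorem measurePreserving_head_tail (n : ℕ) :
    MeasurePreserving (fun K : Fin (n + 1) → R3 => (K 0, Fin.tail K)) volume
      ((volume : Measure R3).prod (volume : Measure (Fin n → R3))) := by
  have h := volume_preserving_piFinSuccAbove (fun _ : Fin (n + 1) => R3) 0
  have e : (MeasurableEquiv.piFinSuccAbove (fun _ : Fin (n + 1) => R3) 0 :
      (Fin (n + 1) → R3) → R3 × (Fin n → R3)) = fun K => (K 0, Fin.tail K) := by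
    funext K
    simp [MeasurableEquiv.piFinSuccAbove, Fin.insertNthEquiv]
  rw [e] at h
  exact h

theorem eLpNorm_head_mul_tail {n : ℕ} {g : R3 → ℂ} {φ : (Fin n → R3) → ℂ}
    (hg : AEStronglyMeasurable g) (hφ : AEStronglyMeasurable φ) :
    eLpNorm (fun K : Fin (n + 1) → R3 => g (K 0) * φ (Fin.tail K)) 2 =
      eLpNorm g 2 * eLpNorm φ 2 := by
  rw [← eLpNorm_prod_mul hg hφ]
  have h : AEStronglyMeasurable (fun y : R3 × (Fin n → R3) => g y.1 * φ y.2)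
      ((volume : Measure R3).prod (volume : Measure (Fin n → R3))) := hg.comp_fst.mul hφ.comp_snd
  rw [← eLpNorm_comp_measurePreserving h (measurePreserving_head_tail n)]
  rfl

/-! ### Multiplication and raising operators on Fock space -/

theorem memLp_sector (Ψ : Fock) (n : ℕ) : MemLp (sector Ψ n) 2 := Lp.memLp _

theorem sector_perm (Ψ : Fock) (n : ℕ) (σ : Equiv.Perm (Fin n)) :
    (fun K => sector Ψ n (K ∘ σ)) =ᵐ[volume] sector Ψ n := (Ψ n).2 σ

theorem L2n_inner_eq {n : ℕ} (φ ψ : L2n n) : inner ℂ φ ψ = ∫ K, conj (φ K) * ψ K := by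
  rw [L2.inner_def]
  refine integral_congr_ae (Eventually.of_forall fun K => ?_)
  simp only [RCLike.inner_apply]
  exact mul_comm _ _

theorem hasSum_inner_sector (Φ Ψ : Fock) :
    HasSum (fun n => ∫ K, conj (sector Φ n K) * sector Ψ n K) (inner ℂ Φ Ψ) := by
  have h := lp.hasSum_inner (𝕜 := ℂ) Φ Ψ
  simp only [Submodule.coe_inner, L2n_inner_eq] at h
  exact h

theorem exists_mulOperator (w : ∀ n, (Fin n → R3) → ℝ) (hm : ∀ n, Measurable (w n))
    (hw : ∀ n K, |w n K| ≤ 1) (hσ : ∀ n K (σ : Equiv.Perm (Fin n)), w n (K ∘ σ) = w n K) :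
    ∃ T : Fock →L[ℂ] Fock, ‖T‖ ≤ 1 ∧
      ∀ Ψ n, sector (T Ψ) n =ᵐ[volume] fun K => (w n K : ℂ) * sector Ψ n K := by
  have hL : ∀ n, ∃ L : L2n n →L[ℂ] L2n n, ‖L‖ ≤ 1 ∧
      ∀ φ, L φ =ᵐ[volume] fun K => (w n K : ℂ) * φ K := fun n => by
    let F : ((Fin n → R3) → ℂ) →ₗ[ℂ] ((Fin n → R3) → ℂ) :=
      { toFun := fun φ K => (w n K : ℂ) * φ K
        map_add' := fun φ ψ => funext fun K => mul_add _ _ _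
        map_smul' := fun c φ => funext fun K => mul_left_comm _ _ _ }
    obtain ⟨L, h1, h2⟩ := exists_L2_clm (μ := volume) (ν := volume) F 1 (fun φ ψ h => by
        filter_upwards [h] with K hK
        change (w n K : ℂ) * _ = (w n K : ℂ) * _
        rw [hK]) (fun φ hφ => ⟨(Complex.measurable_ofReal.comp (hm n)).aestronglyMeasurable.mul
          hφ.1, by
        rw [ENNReal.coe_one, one_mul]
        refine eLpNorm_mono fun K => ?_
        change ‖(w n K : ℂ) * φ K‖ ≤ _
        rw [norm_mul, Complex.norm_real]
        exact mul_le_of_le_one_left (norm_nonneg _) (hw n K)⟩)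
    exact ⟨L, h1, h2⟩
  choose L hL1 hL2 using hL
  have hsym : ∀ n (φ : symL2 n), L n φ ∈ symL2 n := fun n φ σ => by
    filter_upwards [hL2 n φ, φ.2 σ,
      (measurePreserving_perm n σ).quasiMeasurePreserving.ae_eq_comp (hL2 n φ)] with K h1 h2 h3
    simp only [Function.comp_apply] at h3
    rw [h3, h1, hσ, h2]
  obtain ⟨T, hT, h⟩ := exists_lp_diag (E := fun n => symL2 n)
    (fun n => ((L n).comp (symL2 n).subtypeL).codRestrict (symL2 n) (hsym n)) 1 zero_le_one
    fun n => ContinuousLinearMap.opNorm_le_bound _ zero_le_one fun φ => (L n).le_of_opNorm_le (hL1 n) φ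
  refine ⟨T, hT, fun Ψ n => ?_⟩
  have : ((T Ψ n : symL2 n) : L2n n) = L n (Ψ n) := by rw [h]; rfl
  unfold sector
  rw [this]
  exact hL2 n _

theorem isSelfAdjoint_of_mul {T : Fock →L[ℂ] Fock} {w : ∀ n, (Fin n → R3) → ℝ}
    (h : ∀ Ψ n, sector (T Ψ) n =ᵐ[volume] fun K => (w n K : ℂ) * sector Ψ n K) :
    IsSelfAdjoint T := by
  rw [ContinuousLinearMap.isSelfAdjoint_iff_isSymmetric]
  intro Φ Ψ
  refine (hasSum_inner_sector (T Φ) Ψ).unique ?_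
  have h1 := hasSum_inner_sector Φ (T Ψ)
  suffices e : (fun n => ∫ K, conj (sector (T Φ) n K) * sector Ψ n K)
      = fun n => ∫ K, conj (sector Φ n K) * sector (T Ψ) n K by
    rw [e]
    exact h1
  funext n
  refine integral_congr_ae ?_
  filter_upwards [h Φ n, h Ψ n] with K h2 h3
  rw [h2, h3, map_mul, Complex.conj_ofReal]
  ring

theorem quasiMeasurePreserving_tail (n : ℕ) :
    Measure.QuasiMeasurePreserving (fun K : Fin (n + 1) → R3 => Fin.tail K) volume volume :=
  Measure.quasiMeasurePreserving_snd.comp (measurePreserving_head_tail n).quasiMeasurePreserving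

/-- The kernel is dominated by a function of the first momentum alone, so by Tonelli the norm is at
most `‖g‖ ‖φ‖`, whatever `n` is. -/
theorem exists_L2n_raising {n : ℕ} {m : (Fin (n + 1) → R3) → ℂ} (hm : Measurable m)
    {g : R3 → ℂ} (hg : MemLp g 2) (hmg : ∀ K, ‖m K‖ ≤ ‖g (K 0)‖) :
    ∃ L : L2n n →L[ℂ] L2n (n + 1), ‖L‖ ≤ (eLpNorm g 2).toReal ∧
      ∀ φ, L φ =ᵐ[volume] fun K => m K * φ (Fin.tail K) := by
  let F : ((Fin n → R3) → ℂ) →ₗ[ℂ] ((Fin (n + 1) → R3) → ℂ) :=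
    { toFun := fun φ K => m K * φ (Fin.tail K)
      map_add' := fun φ ψ => funext fun K => mul_add _ _ _
      map_smul' := fun c φ => funext fun K => mul_left_comm _ _ _ }
  have hcongr : ∀ φ ψ : (Fin n → R3) → ℂ, φ =ᵐ[volume] ψ → F φ =ᵐ[volume] F ψ := fun φ ψ h => by
    filter_upwards [ae_tail h] with K hK
    change m K * _ = m K * _
    rw [hK]
  have hF : ∀ φ : (Fin n → R3) → ℂ, MemLp φ 2 → AEStronglyMeasurable (F φ) ∧
      eLpNorm (F φ) 2 ≤ (eLpNorm g 2).toNNReal * eLpNorm φ 2 := fun φ hφ => by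
    refine ⟨hm.aestronglyMeasurable.mul
      (hφ.1.comp_quasiMeasurePreserving (quasiMeasurePreserving_tail n)), ?_⟩
    rw [ENNReal.coe_toNNReal hg.2.ne, ← eLpNorm_head_mul_tail hg.1 hφ.1]
    refine eLpNorm_mono fun K => ?_
    change ‖m K * φ (Fin.tail K)‖ ≤ _
    rw [norm_mul, norm_mul]
    exact mul_le_mul_of_nonneg_right (hmg K) (norm_nonneg _)
  exact exists_L2_clm F _ hcongr hF

/-- The product of `m` with `φ` of the last `n` momenta is not symmetric. Projecting it orthogonally
onto the symmetric functions does not increase the norm and is invisible in the pairing with a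
symmetric `χ`, so the explicit symmetrization need not be written down. -/
theorem exists_symL2_raising {n : ℕ} {m : (Fin (n + 1) → R3) → ℂ} (hm : Measurable m)
    {g : R3 → ℂ} (hg : MemLp g 2) (hmg : ∀ K, ‖m K‖ ≤ ‖g (K 0)‖) :
    ∃ L : symL2 n →L[ℂ] symL2 (n + 1), ‖L‖ ≤ (eLpNorm g 2).toReal ∧
      ∀ (χ : symL2 (n + 1)) (φ : symL2 n),
        (Integrable fun K => conj ((χ : L2n (n + 1)) K) * (m K * (φ : L2n n) (Fin.tail K))) ∧
        inner ℂ χ (L φ) =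
          ∫ K, conj ((χ : L2n (n + 1)) K) * (m K * (φ : L2n n) (Fin.tail K)) := by
  obtain ⟨L, hL1, hL2⟩ := exists_L2n_raising hm hg hmg
  refine ⟨(symL2 (n + 1)).orthogonalProjectionOnto.comp (L.comp (symL2 n).subtypeL),
    ContinuousLinearMap.opNorm_le_bound _ ENNReal.toReal_nonneg fun φ =>
      ((symL2 (n + 1)).norm_orthogonalProjectionOnto_apply_le _).trans
        (L.le_of_opNorm_le hL1 φ), fun χ φ => ?_⟩
  have he : (fun K => conj ((χ : L2n (n + 1)) K) * L φ K) =ᵐ[volume]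
      fun K => conj ((χ : L2n (n + 1)) K) * (m K * (φ : L2n n) (Fin.tail K)) := by
    filter_upwards [hL2 φ] with K hK
    rw [hK]
  constructor
  · refine Integrable.congr ?_ he
    have := (Lp.memLp (L φ)).integrable_mul (p := 2) (q := 2)
      (Lp.memLp (χ : L2n (n + 1))).star
    exact this.congr (Eventually.of_forall fun K => mul_comm _ _)
  · rw [← integral_congr_ae he, ← L2n_inner_eq]
    exact Submodule.inner_orthogonalProjectionOnto_eq_of_mem_left χ (L φ)

theorem exists_raisingOperator (m : ∀ n, (Fin (n + 1) → R3) → ℂ) (hm : ∀ n, Measurable (m n))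
    {g : R3 → ℂ} (hg : MemLp g 2) (hmg : ∀ n K, ‖m n K‖ ≤ ‖g (K 0)‖) :
    ∃ U : Fock →L[ℂ] Fock, ‖U‖ ≤ (eLpNorm g 2).toReal ∧ ∀ Φ Ψ,
      (∀ n, Integrable fun K : Fin (n + 1) → R3 =>
        conj (sector Φ (n + 1) K) * (m n K * sector Ψ n (Fin.tail K))) ∧
      HasSum (fun n => ∫ K : Fin (n + 1) → R3,
        conj (sector Φ (n + 1) K) * (m n K * sector Ψ n (Fin.tail K))) (inner ℂ Φ (U Ψ)) := by
  choose L hL1 hL2 using fun n => exists_symL2_raising (hm n) hg (hmg n)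
  obtain ⟨U, hU, hU0, h⟩ := exists_lp_shift L _ ENNReal.toReal_nonneg hL1
  refine ⟨U, hU, fun Φ Ψ => ⟨fun n => (hL2 n _ _).1, ?_⟩⟩
  have h1 := lp.hasSum_inner (𝕜 := ℂ) Φ (U Ψ)
  rw [← hasSum_nat_add_iff' 1] at h1
  simp only [Finset.range_one, Finset.sum_singleton, hU0, inner_zero_right, sub_zero, h,
    (hL2 _ _ _).2] at h1
  exact h1

/-! ### Square integrability of the weighted form factors -/

/-- `(1 + |k|²)^{-1/2}` times the form factor, up to a constant. -/
noncomputable def weighted (f : R3 → ℂ) (k : R3) : ℂ :=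
  ((Real.sqrt 2 / Real.sqrt (1 + ‖k‖ ^ 2) : ℝ) : ℂ) * f k

theorem measurable_vHat : Measurable vHat := by
  unfold vHat
  fun_prop

theorem measurable_vHatCut (Λ : ℝ) : Measurable (vHatCut Λ) :=
  measurable_vHat.indicator (measurableSet_lt measurable_norm measurable_const)

theorem measurable_weighted {f : R3 → ℂ} (hf : Measurable f) : Measurable (weighted f) := by
  unfold weighted
  fun_prop

/-- In polar coordinates the Jacobian `y²` cancels the factor `y⁻²` of `v̂²`, and a multiple of the
integrable function `(1 + y²)⁻¹` remains. -/
theorem memLp_weighted_vHat : MemLp (weighted vHat) 2 := by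
  rw [memLp_two_iff_integrable_sq_norm (measurable_weighted measurable_vHat).aestronglyMeasurable]
  have e : (fun k : R3 => ‖weighted vHat k‖ ^ 2) =
      fun k => (fun y : ℝ => 2 / (1 + y ^ 2) * (1 / (4 * Real.pi * y)) ^ 2) ‖k‖ := by
    funext k
    simp only [weighted, vHat, norm_mul, Complex.norm_real, Real.norm_eq_abs, mul_pow, sq_abs,
      div_pow, Real.sq_sqrt zero_le_two, Real.sq_sqrt (by positivity : 0 ≤ 1 + ‖k‖ ^ 2)]
  rw [e]
  refine (integrable_fun_norm_addHaar (volume : Measure R3)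
    (f := fun y : ℝ => 2 / (1 + y ^ 2) * (1 / (4 * Real.pi * y)) ^ 2)).2 ?_
  have hi : IntegrableOn (fun y : ℝ => 2 / (4 * Real.pi) ^ 2 * (1 + y ^ 2)⁻¹) (Set.Ioi 0) :=
    (integrable_inv_one_add_sq.const_mul _).integrableOn
  refine hi.congr_fun (fun y hy => ?_) measurableSet_Ioi
  have hy0 : y ≠ 0 := ne_of_gt hy
  have h1 : 1 + y ^ 2 ≠ 0 := by positivity
  simp only [finrank_euclideanSpace, Fintype.card_fin, smul_eq_mul]
  field_simp

/-- On the ball of radius `Λ` the weight is at least `(1 + Λ²)^{-1/2}`, so the cutoff form factor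
inherits square integrability from the weighted one. -/
theorem norm_vHatCut_le (Λ : ℝ) (k : R3) :
    ‖vHatCut Λ k‖ ≤ ‖((Real.sqrt (1 + Λ ^ 2) : ℝ) : ℂ) * weighted vHat k‖ := by
  unfold vHatCut
  by_cases hk : ‖k‖ < Λ
  · rw [Set.indicator_of_mem (show k ∈ {k : R3 | ‖k‖ < Λ} from hk), weighted, ← mul_assoc,
      norm_mul (_ * _), ← Complex.ofReal_mul, Complex.norm_real]
    refine le_mul_of_one_le_left (norm_nonneg _) ?_
    have h0 : (0 : ℝ) < Real.sqrt (1 + ‖k‖ ^ 2) := Real.sqrt_pos.2 (by positivity)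
    have h1 : Real.sqrt (1 + ‖k‖ ^ 2) ≤ Real.sqrt (1 + Λ ^ 2) :=
      Real.sqrt_le_sqrt (by nlinarith [norm_nonneg k])
    have h2 : 1 ≤ Real.sqrt 2 := Real.one_le_sqrt.2 one_le_two
    rw [Real.norm_of_nonneg (by positivity), mul_div_assoc', le_div_iff₀ h0]
    nlinarith
  · rw [Set.indicator_of_notMem (show k ∉ {k : R3 | ‖k‖ < Λ} from hk), norm_zero]
    exact norm_nonneg _

theorem memLp_vHatCut (Λ : ℝ) : MemLp (vHatCut Λ) 2 :=
  (memLp_weighted_vHat.const_mul ((Real.sqrt (1 + Λ ^ 2) : ℝ) : ℂ)).mono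
    (measurable_vHatCut Λ).aestronglyMeasurable (Eventually.of_forall (norm_vHatCut_le Λ))

theorem norm_weighted_sub_vHatCut_le (Λ : ℝ) (k : R3) :
    ‖weighted (vHat - vHatCut Λ) k‖ ≤ ‖weighted vHat k‖ := by
  unfold weighted vHatCut
  rw [norm_mul, norm_mul, Pi.sub_apply]
  refine mul_le_mul_of_nonneg_left ?_ (norm_nonneg _)
  by_cases hk : k ∈ {k : R3 | ‖k‖ < Λ}
  · simp [Set.indicator_of_mem hk]
  · simp [Set.indicator_of_notMem hk]

theorem memLp_weighted_sub_vHatCut (Λ : ℝ) : MemLp (weighted (vHat - vHatCut Λ)) 2 :=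
  memLp_weighted_vHat.mono
    (measurable_weighted (measurable_vHat.sub (measurable_vHatCut Λ))).aestronglyMeasurable
    (Eventually.of_forall (norm_weighted_sub_vHatCut_le Λ))

/-- Dominated convergence applies: at each `k` the difference is exactly zero once `Λ > |k|`. -/
theorem tendsto_eLpNorm_weighted_sub_vHatCut :
    Tendsto (fun Λ : ℝ => (eLpNorm (weighted (vHat - vHatCut Λ)) 2).toReal) atTop (𝓝 0) := by
  have h1 : Tendsto (fun Λ : ℝ => ∫⁻ k, ‖weighted (vHat - vHatCut Λ) k‖ₑ ^ 2) atTop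
      (𝓝 (∫⁻ _ : R3, 0)) := by
    refine tendsto_lintegral_filter_of_dominated_convergence (fun k => ‖weighted vHat k‖ₑ ^ 2)
      (Eventually.of_forall fun Λ => ?_) (Eventually.of_forall fun Λ => Eventually.of_forall
        fun k => ?_) ?_ (Eventually.of_forall fun k => ?_)
    · exact (measurable_weighted (measurable_vHat.sub (measurable_vHatCut Λ))).enorm.pow_const 2
    · exact pow_le_pow_left₀ zero_le
        (enorm_le_iff_norm_le.2 (norm_weighted_sub_vHatCut_le Λ k)) 2
    · rw [← eLpNorm_two_sq]
      exact ENNReal.pow_ne_top memLp_weighted_vHat.2.ne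
    · refine tendsto_const_nhds.congr' ?_
      filter_upwards [eventually_gt_atTop ‖k‖] with Λ hΛ
      simp [weighted, vHatCut, Set.indicator_of_mem (show k ∈ {k : R3 | ‖k‖ < Λ} from hΛ)]
  rw [lintegral_zero] at h1
  have h2 := (ENNReal.tendsto_toReal ENNReal.zero_ne_top).comp h1
  have h3 := (Real.continuous_sqrt.tendsto _).comp h2
  simp only [ENNReal.toReal_zero, Real.sqrt_zero] at h3
  refine h3.congr fun Λ => ?_
  simp only [Function.comp_apply, ← eLpNorm_two_sq, ENNReal.toReal_pow]
  exact Real.sqrt_sq ENNReal.toReal_nonneg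

/-! ### The operator `H₀^{-1/2}` -/

/-- The symbol of `H₀^{-1/2}`. -/
noncomputable def invSqrtSymbol (P : R3) (n : ℕ) (K : Fin n → R3) : ℝ :=
  (Real.sqrt (freeSymbol P n K))⁻¹

theorem sqrt_freeSymbol_pos (P : R3) (n : ℕ) (K : Fin n → R3) :
    0 < Real.sqrt (freeSymbol P n K) :=
  Real.sqrt_pos.2 (zero_lt_one.trans_le (one_le_freeSymbol P n K))

theorem invSqrtSymbol_pos (P : R3) (n : ℕ) (K : Fin n → R3) : 0 < invSqrtSymbol P n K :=
  inv_pos.2 (sqrt_freeSymbol_pos P n K)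

theorem invSqrtSymbol_le_one (P : R3) (n : ℕ) (K : Fin n → R3) : invSqrtSymbol P n K ≤ 1 :=
  inv_le_one_of_one_le₀ (Real.one_le_sqrt.2 (one_le_freeSymbol P n K))

theorem measurable_invSqrtSymbol (P : R3) (n : ℕ) : Measurable (invSqrtSymbol P n) :=
  (continuous_freeSymbol P n).sqrt.measurable.inv

theorem freeSymbol_mul_invSqrtSymbol_sq (P : R3) (n : ℕ) (K : Fin n → R3) :
    freeSymbol P n K * invSqrtSymbol P n K ^ 2 = 1 := by
  have h := one_le_freeSymbol P n K
  rw [invSqrtSymbol, inv_pow, Real.sq_sqrt (by linarith), mul_inv_cancel₀ (by linarith)]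

theorem exists_invSqrt (P : R3) : ∃ T : Fock →L[ℂ] Fock, ‖T‖ ≤ 1 ∧ ∀ Ψ n,
    sector (T Ψ) n =ᵐ[volume] fun K => (invSqrtSymbol P n K : ℂ) * sector Ψ n K :=
  exists_mulOperator (invSqrtSymbol P) (measurable_invSqrtSymbol P)
    (fun n K => by
      rw [abs_of_pos (invSqrtSymbol_pos P n K)]
      exact invSqrtSymbol_le_one P n K)
    (fun n K σ => by rw [invSqrtSymbol, freeSymbol_perm]; rfl)

/-- The bounded operator `H₀^{-1/2}`. -/
noncomputable def invSqrt (P : R3) : Fock →L[ℂ] Fock := (exists_invSqrt P).choose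

theorem norm_invSqrt_le (P : R3) : ‖invSqrt P‖ ≤ 1 := (exists_invSqrt P).choose_spec.1

theorem sector_invSqrt (P : R3) (Ψ : Fock) (n : ℕ) :
    sector (invSqrt P Ψ) n =ᵐ[volume] fun K => (invSqrtSymbol P n K : ℂ) * sector Ψ n K :=
  (exists_invSqrt P).choose_spec.2 Ψ n

theorem isSelfAdjoint_invSqrt (P : R3) : IsSelfAdjoint (invSqrt P) :=
  isSelfAdjoint_of_mul (sector_invSqrt P)

/-- Parametrizing the form domain by all of Fock space turns statements about the unbounded form
into statements about bounded operators. -/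
theorem mem_formDomain_iff (P : R3) (Ψ : Fock) :
    Ψ ∈ formDomain P ↔ ∃ x, invSqrt P x = Ψ := by
  constructor
  · rintro ⟨x, hx⟩
    refine ⟨x, Fock.ext_sector fun n => ?_⟩
    filter_upwards [sector_invSqrt P x n, hx n] with K h1 h2
    rw [h1, h2, ← mul_assoc, ← Complex.ofReal_mul, invSqrtSymbol,
      inv_mul_cancel₀ (sqrt_freeSymbol_pos P n K).ne', Complex.ofReal_one, one_mul]
  · rintro ⟨x, rfl⟩
    refine ⟨x, fun n => ?_⟩
    filter_upwards [sector_invSqrt P x n] with K h1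
    rw [h1, ← mul_assoc, ← Complex.ofReal_mul, invSqrtSymbol,
      mul_inv_cancel₀ (sqrt_freeSymbol_pos P n K).ne', Complex.ofReal_one, one_mul]

theorem sector_invSqrt_invSqrt (P : R3) (Ψ : Fock) (n : ℕ) :
    sector (invSqrt P (invSqrt P Ψ)) n =ᵐ[volume]
      fun K => ((invSqrtSymbol P n K ^ 2 : ℝ) : ℂ) * sector Ψ n K := by
  filter_upwards [sector_invSqrt P (invSqrt P Ψ) n, sector_invSqrt P Ψ n] with K h1 h2
  rw [h1, h2]
  push_cast
  ring

theorem freeSymbol_mul_sector (P : R3) (x : Fock) (n : ℕ) :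
    (fun K => (freeSymbol P n K : ℂ) * sector (invSqrt P (invSqrt P x)) n K) =ᵐ[volume]
      sector x n := by
  filter_upwards [sector_invSqrt_invSqrt P x n] with K h1
  rw [h1, ← mul_assoc, ← Complex.ofReal_mul, freeSymbol_mul_invSqrtSymbol_sq, Complex.ofReal_one,
    one_mul]

theorem mem_freeDomain_iff (P : R3) (Ψ : Fock) :
    Ψ ∈ freeDomain P ↔ ∃ x, invSqrt P (invSqrt P x) = Ψ := by
  constructor
  · rintro ⟨x, hx⟩
    refine ⟨x, Fock.ext_sector fun n => ?_⟩
    filter_upwards [sector_invSqrt_invSqrt P x n, hx n] with K h1 h2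
    rw [h1, h2, ← mul_assoc, ← Complex.ofReal_mul, mul_comm (_ ^ 2),
      freeSymbol_mul_invSqrtSymbol_sq, Complex.ofReal_one, one_mul]
  · rintro ⟨x, rfl⟩
    exact ⟨x, fun n => (freeSymbol_mul_sector P x n).symm⟩

/-! ### The coupling in the form sense -/

/-- This estimate is the source of the uniformity in `P`. With `a = |P - P_f|` before and `b = |P -
P_f|` after a phonon of momentum `k` is added, `|k| ≤ a + b`, so `|k|² ≤ 2 a² + 2 b²`. Then `(n +
1)(1 + |k|²) ≤ 2 (a² + n + 1)(b² + n + 2)`: each momentum term needs the number operator from the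
other factor only. -/
theorem coupling_weight_le (P : R3) (n : ℕ) (K : Fin (n + 1) → R3) :
    Real.sqrt (n + 1) * (invSqrtSymbol P n (Fin.tail K) * invSqrtSymbol P (n + 1) K) ≤
      Real.sqrt 2 / Real.sqrt (1 + ‖K 0‖ ^ 2) := by
  have h1 := one_le_freeSymbol P n (Fin.tail K)
  have h2 := one_le_freeSymbol P (n + 1) K
  have h3 : (n + 1 : ℝ) * (1 + ‖K 0‖ ^ 2) ≤
      2 * (freeSymbol P n (Fin.tail K) * freeSymbol P (n + 1) K) := by
    have hs : ‖K 0‖ ≤ ‖P - ∑ j, Fin.tail K j‖ + ‖P - ∑ j, K j‖ := by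
      have : K 0 = (P - ∑ j, Fin.tail K j) - (P - ∑ j, K j) := by
        rw [Fin.sum_univ_succ]
        simp only [Fin.tail]
        abel
      calc ‖K 0‖ = ‖(P - ∑ j, Fin.tail K j) - (P - ∑ j, K j)‖ := by rw [← this]
        _ ≤ _ := norm_sub_le _ _
    unfold freeSymbol
    set a := ‖P - ∑ j, Fin.tail K j‖
    set b := ‖P - ∑ j, K j‖
    have hn : (0 : ℝ) ≤ n := n.cast_nonneg
    have ha : 0 ≤ a := norm_nonneg _
    have hb : 0 ≤ b := norm_nonneg _
    have hk : ‖K 0‖ ^ 2 ≤ 2 * a ^ 2 + 2 * b ^ 2 := by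
      nlinarith [sq_nonneg (a - b), norm_nonneg (K 0)]
    push_cast
    have h4 : (n + 1 : ℝ) * ‖K 0‖ ^ 2 ≤ (n + 1) * (2 * a ^ 2 + 2 * b ^ 2) :=
      mul_le_mul_of_nonneg_left hk (by positivity)
    nlinarith [mul_nonneg (sq_nonneg a) (sq_nonneg b), sq_nonneg a, mul_nonneg hn hn]
  rw [invSqrtSymbol, invSqrtSymbol, ← mul_inv, ← Real.sqrt_mul (by linarith), ← div_eq_mul_inv,
    ← Real.sqrt_div' _ (by positivity), ← Real.sqrt_div' _ (by positivity)]
  refine Real.sqrt_le_sqrt ?_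
  rw [div_le_div_iff₀ (by positivity) (by positivity)]
  exact h3

/-- The integral kernel of `H₀^{-1/2} a*(f) H₀^{-1/2}`. -/
noncomputable def couplingKernel (P : R3) (f : R3 → ℂ) (n : ℕ) (K : Fin (n + 1) → R3) : ℂ :=
  (Real.sqrt (n + 1) : ℂ) * f (K 0) *
    ((invSqrtSymbol P n (Fin.tail K) : ℂ) * (invSqrtSymbol P (n + 1) K : ℂ))

/-- `U` raises the phonon number by one and has the integral kernel `m`, up to
symmetrization. -/
def IsRaising (m : ∀ n, (Fin (n + 1) → R3) → ℂ) (U : Fock →L[ℂ] Fock) : Prop :=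
  ∀ Φ Ψ, (∀ n, Integrable fun K : Fin (n + 1) → R3 =>
      conj (sector Φ (n + 1) K) * (m n K * sector Ψ n (Fin.tail K))) ∧
    HasSum (fun n => ∫ K : Fin (n + 1) → R3,
      conj (sector Φ (n + 1) K) * (m n K * sector Ψ n (Fin.tail K))) (inner ℂ Φ (U Ψ))

theorem measurable_tail (n : ℕ) : Measurable (Fin.tail : (Fin (n + 1) → R3) → Fin n → R3) :=
  measurable_pi_lambda _ fun i => measurable_pi_apply i.succ

theorem exists_coupling (P : R3) {f : R3 → ℂ} (hf : Measurable f) (hw : MemLp (weighted f) 2) :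
    ∃ U : Fock →L[ℂ] Fock, ‖U‖ ≤ (eLpNorm (weighted f) 2).toReal ∧
      IsRaising (couplingKernel P f) U := by
  refine exists_raisingOperator _ (fun n => ?_) hw fun n K => ?_
  · have h1 := (measurable_invSqrtSymbol P n).comp (measurable_tail n)
    have h2 := measurable_invSqrtSymbol P (n + 1)
    have h3 : Measurable fun K : Fin (n + 1) → R3 => f (K 0) := hf.comp (measurable_pi_apply 0)
    exact (h3.const_mul _).mul ((Complex.measurable_ofReal.comp h1).mul
      (Complex.measurable_ofReal.comp h2))
  · have h := coupling_weight_le P n K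
    have h1 := invSqrtSymbol_pos P n (Fin.tail K)
    have h2 := invSqrtSymbol_pos P (n + 1) K
    rw [couplingKernel, weighted, mul_right_comm, norm_mul, norm_mul _ (f (K 0)),
      ← Complex.ofReal_mul, ← Complex.ofReal_mul, Complex.norm_real, Complex.norm_real,
      Real.norm_of_nonneg (by positivity), Real.norm_of_nonneg (by positivity)]
    exact mul_le_mul_of_nonneg_right h (norm_nonneg _)

theorem IsRaising.ext {m : ∀ n, (Fin (n + 1) → R3) → ℂ} {U V : Fock →L[ℂ] Fock}
    (hU : IsRaising m U) (hV : IsRaising m V) : U = V :=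
  ContinuousLinearMap.ext fun Ψ => ext_inner_left ℂ fun Φ =>
    (hU Φ Ψ).2.unique (hV Φ Ψ).2

theorem IsRaising.sub {m m' : ∀ n, (Fin (n + 1) → R3) → ℂ} {U V : Fock →L[ℂ] Fock}
    (hU : IsRaising m U) (hV : IsRaising m' V) : IsRaising (fun n => m n - m' n) (U - V) := by
  intro Φ Ψ
  have e : ∀ n, (fun K : Fin (n + 1) → R3 =>
      conj (sector Φ (n + 1) K) * ((m n - m' n) K * sector Ψ n (Fin.tail K))) = fun K =>
      conj (sector Φ (n + 1) K) * (m n K * sector Ψ n (Fin.tail K)) -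
      conj (sector Φ (n + 1) K) * (m' n K * sector Ψ n (Fin.tail K)) := fun n => by
    funext K
    rw [Pi.sub_apply]
    ring
  simp only [e]
  refine ⟨fun n => ((hU Φ Ψ).1 n).sub ((hV Φ Ψ).1 n), ?_⟩
  simp only [integral_sub ((hU Φ Ψ).1 _) ((hV Φ Ψ).1 _)]
  rw [sub_apply, inner_sub_right]
  exact (hU Φ Ψ).2.sub (hV Φ Ψ).2

/-- The coupling operators depend on the form factor Lipschitz continuously, uniformly in the
total momentum. -/
theorem norm_coupling_sub_le {P : R3} {f f' : R3 → ℂ} (hf : Measurable f) (hf' : Measurable f')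
    (hw : MemLp (weighted (f - f')) 2) {U U' : Fock →L[ℂ] Fock}
    (hU : IsRaising (couplingKernel P f) U) (hU' : IsRaising (couplingKernel P f') U') :
    ‖U - U'‖ ≤ (eLpNorm (weighted (f - f')) 2).toReal := by
  -- The kernel is linear in the form factor and determines the operator, so `U - U'` is the
  -- coupling operator of `f - f'`.
  obtain ⟨V, hV, h⟩ := exists_coupling P (hf.sub hf') hw
  have e : couplingKernel P (f - f') = fun n => couplingKernel P f n - couplingKernel P f' n := by
    funext n K
    simp only [couplingKernel, Pi.sub_apply]
    ring
  rw [e] at h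
  rwa [(hU.sub hU').ext h]

/-! ### The form Hamiltonian in terms of the coupling operator -/

section Abstract

variable {H : Type*} [NormedAddCommGroup H] [InnerProductSpace ℂ H] [CompleteSpace H]

/-- The bounded form perturbation `√α (U + U*)`. -/
noncomputable def fieldPerturbation (α : ℝ) (U : H →L[ℂ] H) : H →L[ℂ] H :=
  (Real.sqrt α : ℂ) • (U + star U)

theorem fieldPerturbation_apply (α : ℝ) (U : H →L[ℂ] H) (x : H) :
    fieldPerturbation α U x = (Real.sqrt α : ℂ) • (U x + ContinuousLinearMap.adjoint U x) := rfl

theorem isSelfAdjoint_fieldPerturbation (α : ℝ) (U : H →L[ℂ] H) :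
    IsSelfAdjoint (fieldPerturbation α U) :=
  IsSelfAdjoint.smul (Complex.conj_ofReal _) (IsSelfAdjoint.add_star_self U)

theorem norm_fieldPerturbation_sub_le (α : ℝ) (U V : H →L[ℂ] H) :
    ‖fieldPerturbation α U - fieldPerturbation α V‖ ≤ 2 * Real.sqrt α * ‖U - V‖ := by
  have e : fieldPerturbation α U - fieldPerturbation α V
      = (Real.sqrt α : ℂ) • ((U - V) + star (U - V)) := by
    rw [fieldPerturbation, fieldPerturbation, ← smul_sub, star_sub]
    congr 1
    abel
  rw [e, norm_smul, Complex.norm_real, Real.norm_of_nonneg (Real.sqrt_nonneg _)]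
  have h := norm_add_le (U - V) (star (U - V))
  rw [norm_star] at h
  nlinarith [Real.sqrt_nonneg α]

end Abstract

theorem freeKernel_invSqrt (P : R3) (x y : Fock) (n : ℕ) :
    freeKernel P (sector (invSqrt P x) n) (sector (invSqrt P y) n) =ᵐ[volume]
      fun K => conj (sector x n K) * sector y n K := by
  filter_upwards [sector_invSqrt P x n, sector_invSqrt P y n] with K h1 h2
  have h3 : (freeSymbol P n K : ℂ) * (invSqrtSymbol P n K : ℂ) ^ 2 = 1 := by
    exact_mod_cast freeSymbol_mul_invSqrtSymbol_sq P n K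
  rw [freeKernel, h1, h2, map_mul, Complex.conj_ofReal]
  linear_combination (conj (sector x n K) * sector y n K) * h3

theorem sqrt_succ_ne_zero (n : ℕ) : (Real.sqrt (n + 1) : ℂ) ≠ 0 := by
  exact_mod_cast (Real.sqrt_pos.2 (by positivity : (0 : ℝ) < n + 1)).ne'

theorem annihKernel_invSqrt (P : R3) (f : R3 → ℂ) (x y : Fock) (n : ℕ) :
    annihKernel f (sector (invSqrt P x) n) (sector (invSqrt P y) (n + 1)) =ᵐ[volume]
      fun K => (Real.sqrt (n + 1) : ℂ)⁻¹ * conj (conj (sector y (n + 1) K) *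
        (couplingKernel P f n K * sector x n (Fin.tail K))) := by
  filter_upwards [ae_tail (sector_invSqrt P x n), sector_invSqrt P y (n + 1)] with K h1 h2
  have h3 := sqrt_succ_ne_zero n
  rw [annihKernel, h1, h2, couplingKernel]
  simp only [map_mul, Complex.conj_ofReal, Complex.conj_conj]
  field_simp

theorem integrable_conj {X : Type*} [MeasurableSpace X] {μ : Measure X} {f : X → ℂ}
    (hf : Integrable f μ) : Integrable (fun x => conj (f x)) μ :=
  (Complex.conjCLE : ℂ ≃L[ℝ] ℂ).toContinuousLinearMap.integrable_comp hf

theorem annihKernel_invSqrt_integrable {P : R3} {f : R3 → ℂ} {U : Fock →L[ℂ] Fock}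
    (hU : IsRaising (couplingKernel P f) U) (x y : Fock) (n : ℕ) :
    Integrable (annihKernel f (sector (invSqrt P x) n) (sector (invSqrt P y) (n + 1))) :=
  ((integrable_conj ((hU y x).1 n)).const_mul _).congr (annihKernel_invSqrt P f x y n).symm

theorem annihForm_invSqrt (P : R3) (f : R3 → ℂ) (x y : Fock) (n : ℕ) :
    annihForm f (sector (invSqrt P x) n) (sector (invSqrt P y) (n + 1)) =
      conj (∫ K, conj (sector y (n + 1) K) *
        (couplingKernel P f n K * sector x n (Fin.tail K))) := by
  rw [annihForm, integral_congr_ae (annihKernel_invSqrt P f x y n), integral_const_mul,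
    ← mul_assoc, mul_inv_cancel₀ (sqrt_succ_ne_zero n), one_mul]
  exact integral_conj

/-- Substituting `T x` and `T y` cancels `H₀` and turns the form into that of `1 + B`. The
annihilation term becomes `⟨x, U* y⟩` and its conjugate counterpart becomes `⟨x, U y⟩`. -/
theorem hasForm_invSqrt (α : ℝ) {P : R3} {U : Fock →L[ℂ] Fock}
    (hU : IsRaising (couplingKernel P vHat) U) (x y : Fock) :
    HasForm α P (invSqrt P x) (invSqrt P y) (inner ℂ x (y + fieldPerturbation α U y)) := by
  refine ⟨fun n => ⟨?_, annihKernel_invSqrt_integrable hU x y n,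
    annihKernel_invSqrt_integrable hU y x n⟩, ?_⟩
  · refine Integrable.congr ?_ (freeKernel_invSqrt P x y n).symm
    exact ((memLp_sector y n).integrable_mul (p := 2) (q := 2) (memLp_sector x n).star).congr
      (Eventually.of_forall fun K => mul_comm _ _)
  · have h1 := hasSum_inner_sector x y
    have h2 := Complex.hasSum_conj'.2 ((hU y x).2)
    have h3 := (hU x y).2
    have h4 := h1.add ((h2.add h3).mul_left (Real.sqrt α : ℂ))
    have e : (inner ℂ x (y + fieldPerturbation α U y) : ℂ) =
        inner ℂ x y + (Real.sqrt α : ℂ) * (conj (inner ℂ y (U x)) + inner ℂ x (U y)) := by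
      rw [fieldPerturbation_apply, inner_add_right, inner_smul_right,
        inner_add_right, inner_conj_symm, ContinuousLinearMap.adjoint_inner_right, add_comm (inner ℂ x (U y))]
    have e' : formTerm α P (invSqrt P x) (invSqrt P y) = fun n =>
        (∫ K, conj (sector x n K) * sector y n K) + (Real.sqrt α : ℂ) *
          (conj (∫ K : Fin (n + 1) → R3, conj (sector y (n + 1) K) *
            (couplingKernel P vHat n K * sector x n (Fin.tail K))) +
          ∫ K : Fin (n + 1) → R3, conj (sector x (n + 1) K) *
            (couplingKernel P vHat n K * sector y n (Fin.tail K))) := by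
      funext n
      rw [formTerm, integral_congr_ae (freeKernel_invSqrt P x y n), annihForm_invSqrt,
        annihForm_invSqrt, Complex.conj_conj]
    rw [e, e']
    exact h4

theorem mem_fiberGraph_iff (α : ℝ) {P : R3} {U : Fock →L[ℂ] Fock}
    (hU : IsRaising (couplingKernel P vHat) U) (Ψ η : Fock) :
    (Ψ, η) ∈ fiberGraph α P ↔
      ∃ y, invSqrt P y = Ψ ∧ y + fieldPerturbation α U y = invSqrt P (η + Ψ) := by
  have hT : ∀ x z, inner ℂ (invSqrt P x) z = inner ℂ x (invSqrt P z) :=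
    (ContinuousLinearMap.isSelfAdjoint_iff_isSymmetric.1 (isSelfAdjoint_invSqrt P))
  constructor
  · rintro ⟨h1, h2⟩
    obtain ⟨y, hy⟩ := (mem_formDomain_iff P Ψ).1 h1
    change invSqrt P y = Ψ at hy
    subst hy
    refine ⟨y, rfl, ext_inner_left ℂ fun x => ?_⟩
    have h3 := h2 _ ((mem_formDomain_iff P _).2 ⟨x, rfl⟩)
    rw [← hT]
    exact (hasForm_invSqrt α hU x y).2.unique h3.2
  · rintro ⟨y, rfl, hy⟩
    refine ⟨(mem_formDomain_iff P _).2 ⟨y, rfl⟩, fun Φ hΦ => ?_⟩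
    obtain ⟨x, rfl⟩ := (mem_formDomain_iff P Φ).1 hΦ
    have h := hasForm_invSqrt α hU x y
    rw [hy, ← hT] at h
    exact h

/-! ### Creation and annihilation operators with a square integrable form factor -/

theorem integral_comp_of_measurePreserving {X Y : Type*} [MeasurableSpace X] [MeasurableSpace Y]
    {μ : Measure X} {ν : Measure Y} {p : X → Y} (hp : MeasurePreserving p μ ν) {g : Y → ℂ}
    (hg : AEStronglyMeasurable g ν) : ∫ x, g (p x) ∂μ = ∫ y, g y ∂ν := by
  have h := integral_map (μ := μ) hp.measurable.aemeasurable (f := g) (by rwa [hp.map_eq])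
  rw [← h, hp.map_eq]

theorem measurePreserving_cons (n : ℕ) :
    MeasurePreserving (fun y : R3 × (Fin n → R3) => (Fin.cons y.1 y.2 : Fin (n + 1) → R3))
      ((volume : Measure R3).prod (volume : Measure (Fin n → R3))) volume := by
  have h := (volume_preserving_piFinSuccAbove (fun _ : Fin (n + 1) => R3) 0).symm
  have e : ((MeasurableEquiv.piFinSuccAbove (fun _ : Fin (n + 1) => R3) 0).symm :
      R3 × (Fin n → R3) → (Fin (n + 1) → R3)) = fun y => Fin.cons y.1 y.2 := by
    funext y
    simp [MeasurableEquiv.piFinSuccAbove, Fin.insertNthEquiv, Fin.insertNth_zero']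
  rw [e] at h
  exact h

/-- Invariance of a function under permutations of the momenta, almost everywhere. -/
def IsSymm {n : ℕ} (φ : (Fin n → R3) → ℂ) : Prop :=
  ∀ σ : Equiv.Perm (Fin n), (fun K => φ (K ∘ σ)) =ᵐ[volume] φ

/-- A permutation fixing `0` only permutes the remaining momenta, and the symmetric `φ` absorbs it.
-/
theorem comp_perm_of_fix_zero {n : ℕ} {φ : (Fin n → R3) → ℂ} (hφ : IsSymm φ) (f : R3 → ℂ)
    (ρ : Equiv.Perm (Fin (n + 1))) (hρ : ρ 0 = 0) :
    (fun K : Fin (n + 1) → R3 => f ((K ∘ ρ) 0) * φ (Fin.tail (K ∘ ρ))) =ᵐ[volume]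
      fun K => f (K 0) * φ (Fin.tail K) := by
  obtain ⟨⟨p, τ⟩, rfl⟩ := Equiv.Perm.decomposeFin.symm.surjective ρ
  rw [Equiv.Perm.decomposeFin_symm_apply_zero] at hρ
  subst hρ
  filter_upwards [ae_tail (hφ τ)] with K hK
  have e : Fin.tail (K ∘ Equiv.Perm.decomposeFin.symm (0, τ)) = Fin.tail K ∘ τ := by
    funext i
    simp [Fin.tail]
  rw [e, hK]
  simp

/-- The inverse of `j.cycleRange` brings the `j`-th momentum to the front and keeps the order of the
others. Each summand is thus the same function composed with a measure preserving permutation. -/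
theorem creat_eq_sum_perm {n : ℕ} (f : R3 → ℂ) (φ : (Fin n → R3) → ℂ) (K : Fin (n + 1) → R3) :
    creat f n φ K = (Real.sqrt (n + 1) : ℂ)⁻¹ * ∑ j : Fin (n + 1),
      f ((K ∘ j.cycleRange.symm) 0) * φ (Fin.tail (K ∘ j.cycleRange.symm)) := by
  unfold creat
  congr 1
  refine Finset.sum_congr rfl fun j _ => ?_
  have e : Fin.tail (K ∘ j.cycleRange.symm) = j.removeNth K := by
    funext i
    simp [Fin.tail, Fin.removeNth]
  rw [e, Function.comp_apply, Fin.cycleRange_symm_zero]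

theorem memLp_head_mul_tail {n : ℕ} {f : R3 → ℂ} (hf : MemLp f 2) {φ : (Fin n → R3) → ℂ}
    (hφ : MemLp φ 2) : MemLp (fun K : Fin (n + 1) → R3 => f (K 0) * φ (Fin.tail K)) 2 := by
  refine ⟨?_, ?_⟩
  · exact (hf.1.comp_fst.mul hφ.1.comp_snd).comp_measurePreserving (measurePreserving_head_tail n)
  · rw [eLpNorm_head_mul_tail hf.1 hφ.1]
    exact ENNReal.mul_lt_top hf.2 hφ.2

section Creation

variable {n : ℕ} {f : R3 → ℂ} {φ : (Fin n → R3) → ℂ}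

theorem memLp_head_mul_tail_perm (hf : MemLp f 2) (hφ : MemLp φ 2)
    (σ : Equiv.Perm (Fin (n + 1))) :
    MemLp (fun K : Fin (n + 1) → R3 => f ((K ∘ σ) 0) * φ (Fin.tail (K ∘ σ))) 2 :=
  (memLp_head_mul_tail hf hφ).comp_measurePreserving (measurePreserving_perm (n + 1) σ)

theorem memLp_creat (hf : MemLp f 2) (hφ : MemLp φ 2) : MemLp (creat f n φ) 2 := by
  have h := (memLp_finsetSum Finset.univ fun (j : Fin (n + 1)) _ =>
    memLp_head_mul_tail_perm hf hφ j.cycleRange.symm).const_mul (Real.sqrt (n + 1) : ℂ)⁻¹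
  exact h.ae_eq (Eventually.of_forall fun K => (creat_eq_sum_perm f φ K).symm)

/-- Applying `σ` turns the summand `j` into the summand `σ j`: the two arrangements differ by `(σ
j).cycleRange * σ * j.cycleRange.symm`, which fixes `0`. -/
theorem isSymm_creat (hφ : IsSymm φ) : IsSymm (creat f n φ) := by
  intro σ
  have key : ∀ j : Fin (n + 1), ∀ᵐ K : Fin (n + 1) → R3,
      f (((K ∘ σ) ∘ j.cycleRange.symm) 0) * φ (Fin.tail ((K ∘ σ) ∘ j.cycleRange.symm)) =
        f ((K ∘ (σ j).cycleRange.symm) 0) * φ (Fin.tail (K ∘ (σ j).cycleRange.symm)) := fun j => by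
    have h := comp_perm_of_fix_zero hφ f ((σ j).cycleRange * (σ * j.cycleRange.symm)) (by simp)
    have h' := (measurePreserving_perm (n + 1)
      (σ j).cycleRange.symm).quasiMeasurePreserving.ae_eq_comp h
    filter_upwards [h'] with K hK
    have e : (K ∘ (σ j).cycleRange.symm) ∘ ((σ j).cycleRange * (σ * j.cycleRange.symm))
        = (K ∘ σ) ∘ j.cycleRange.symm := by
      funext i
      simp
    change f (((K ∘ (σ j).cycleRange.symm) ∘ _) 0) * φ (Fin.tail ((K ∘ (σ j).cycleRange.symm) ∘ _))
      = _ at hK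
    rw [e] at hK
    exact hK
  filter_upwards [ae_all_iff.2 key] with K hK
  rw [creat_eq_sum_perm, creat_eq_sum_perm, Finset.sum_congr rfl fun j _ => hK j]
  rw [Equiv.sum_comp σ fun j => f ((K ∘ j.cycleRange.symm) 0) *
    φ (Fin.tail (K ∘ j.cycleRange.symm))]

/-- Against a symmetric `χ` all `n + 1` summands have the same integral, and `(n + 1)^{-1/2} (n + 1)
= √(n + 1)`. This matches `creat` with the unsymmetrized kernels above. -/
theorem integral_conj_mul_creat (hf : MemLp f 2) (hφ : MemLp φ 2)
    {χ : (Fin (n + 1) → R3) → ℂ} (hχ : MemLp χ 2) (hχs : IsSymm χ) :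
    ∫ K, conj (χ K) * creat f n φ K =
      ∫ K, conj (χ K) * ((Real.sqrt (n + 1) : ℂ) * (f (K 0) * φ (Fin.tail K))) := by
  have hi : ∀ σ : Equiv.Perm (Fin (n + 1)), Integrable fun K : Fin (n + 1) → R3 =>
      conj (χ K) * (f ((K ∘ σ) 0) * φ (Fin.tail (K ∘ σ))) := fun σ =>
    ((memLp_head_mul_tail_perm hf hφ σ).integrable_mul (p := 2) (q := 2) hχ.star).congr
      (Eventually.of_forall fun K => mul_comm _ _)
  have he : ∀ σ : Equiv.Perm (Fin (n + 1)),
      ∫ K, conj (χ K) * (f ((K ∘ σ) 0) * φ (Fin.tail (K ∘ σ))) =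
        ∫ K, conj (χ K) * (f (K 0) * φ (Fin.tail K)) := fun σ => by
    have h1 : AEStronglyMeasurable fun K : Fin (n + 1) → R3 =>
      conj (χ K) * (f (K 0) * φ (Fin.tail K)) := (hi 1).1
    rw [← integral_comp_of_measurePreserving (measurePreserving_perm (n + 1) σ) h1]
    refine integral_congr_ae ?_
    filter_upwards [hχs σ] with K hK
    simp only [hK]
  have h1 : ∀ K, conj (χ K) * creat f n φ K = (Real.sqrt (n + 1) : ℂ)⁻¹ * ∑ j : Fin (n + 1),
      conj (χ K) * (f ((K ∘ j.cycleRange.symm) 0) *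
        φ (Fin.tail (K ∘ j.cycleRange.symm))) := fun K => by
    rw [creat_eq_sum_perm, ← Finset.mul_sum]
    ring
  simp only [h1]
  rw [integral_const_mul, integral_finsetSum _ fun j _ => hi _]
  simp only [he, mul_left_comm _ (Real.sqrt (n + 1) : ℂ), integral_const_mul]
  rw [Finset.sum_const, Finset.card_univ, Fintype.card_fin, nsmul_eq_mul, ← mul_assoc]
  congr 1
  have h2 := sqrt_succ_ne_zero n
  have h3 : (Real.sqrt (n + 1) : ℂ) * (Real.sqrt (n + 1) : ℂ) = n + 1 := by
    rw [← Complex.ofReal_mul, Real.mul_self_sqrt (by positivity)]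
    push_cast
    rfl
  push_cast
  rw [← h3, inv_mul_cancel_left₀ h2]

end Creation

section Annihilation

variable {n : ℕ} {f : R3 → ℂ} {ψ : (Fin (n + 1) → R3) → ℂ}

theorem aestronglyMeasurable_cons (hψ : AEStronglyMeasurable ψ) :
    AEStronglyMeasurable (fun y : R3 × (Fin n → R3) => ψ (Fin.cons y.1 y.2))
      ((volume : Measure R3).prod (volume : Measure (Fin n → R3))) :=
  hψ.comp_measurePreserving (measurePreserving_cons n)

theorem eLpNorm_sq_eq_lintegral_cons (hψ : AEStronglyMeasurable ψ) :
    eLpNorm ψ 2 ^ 2 = ∫⁻ K : Fin n → R3, eLpNorm (fun k : R3 => ψ (Fin.cons k K)) 2 ^ 2 := by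
  have h := eLpNorm_comp_measurePreserving (p := 2) hψ (measurePreserving_cons n)
  rw [← h, eLpNorm_two_sq]
  simp only [Function.comp_apply]
  rw [lintegral_prod_symm _ ((aestronglyMeasurable_cons hψ).enorm.pow_const 2)]
  simp only [eLpNorm_two_sq]

theorem ae_memLp_cons (hψ : MemLp ψ 2) :
    ∀ᵐ K : Fin n → R3, MemLp (fun k : R3 => ψ (Fin.cons k K)) 2 := by
  have h1 := (aestronglyMeasurable_cons hψ.1).prodMk_right
  have hm : AEMeasurable fun K : Fin n → R3 => eLpNorm (fun k : R3 => ψ (Fin.cons k K)) 2 ^ 2 := by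
    simp only [eLpNorm_two_sq]
    exact ((aestronglyMeasurable_cons hψ.1).enorm.pow_const 2).prod_swap.lintegral_prod_right'
  have h2 : ∫⁻ K : Fin n → R3, eLpNorm (fun k : R3 => ψ (Fin.cons k K)) 2 ^ 2 ≠ ∞ := by
    rw [← eLpNorm_sq_eq_lintegral_cons hψ.1]
    exact ENNReal.pow_ne_top hψ.2.ne
  filter_upwards [h1, ae_lt_top' hm h2] with K h3 h4
  exact ⟨h3, (ENNReal.pow_lt_top_iff.1 h4).resolve_right two_ne_zero⟩

theorem annihConverges_of_memLp (hf : MemLp f 2) (hψ : MemLp ψ 2) : AnnihConverges f n ψ := by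
  filter_upwards [ae_memLp_cons hψ] with K hK
  exact hf.star.integrable_mul (p := 2) (q := 2) hK

/-- Cauchy–Schwarz in the integrated momentum, for almost every value of the others, followed by
Tonelli. -/
theorem memLp_annih (hf : MemLp f 2) (hψ : MemLp ψ 2) : MemLp (annih f n ψ) 2 := by
  have hm : AEStronglyMeasurable (annih f n ψ) := by
    refine AEStronglyMeasurable.const_mul ?_ _
    have h := (hf.star.1.comp_fst (ν := (volume : Measure (Fin n → R3)))).mul
      (aestronglyMeasurable_cons hψ.1)
    exact h.prod_swap.integral_prod_right'
  refine ⟨hm, ?_⟩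
  have h1 : eLpNorm (annih f n ψ) 2 ^ 2 ≤
      (‖(Real.sqrt (n + 1) : ℂ)‖ₑ * eLpNorm f 2) ^ 2 * eLpNorm ψ 2 ^ 2 := by
    rw [eLpNorm_two_sq, eLpNorm_sq_eq_lintegral_cons hψ.1, ← lintegral_const_mul'
      _ _ (ENNReal.pow_ne_top (ENNReal.mul_ne_top enorm_ne_top hf.2.ne))]
    refine lintegral_mono_ae ?_
    filter_upwards [ae_memLp_cons hψ] with K hK
    rw [← mul_pow, annih, enorm_mul, mul_assoc]
    gcongr
    refine (enorm_integral_le_lintegral_enorm _).trans ?_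
    rw [← eLpNorm_one_eq_lintegral_enorm]
    have h2 := eLpNorm_smul_le_mul_eLpNorm (p := 2) (q := 2) (r := 1) hK.1 hf.star.1
    rw [eLpNorm_star] at h2
    exact h2
  refine (ENNReal.pow_lt_top_iff.1 (h1.trans_lt ?_)).resolve_right two_ne_zero
  exact ENNReal.mul_lt_top (ENNReal.pow_lt_top (ENNReal.mul_lt_top enorm_lt_top hf.2))
    (ENNReal.pow_lt_top hψ.2)

theorem isSymm_annih (hψ : IsSymm ψ) : IsSymm (annih f n ψ) := by
  intro σ
  -- `decomposeFin.symm (0, σ)` is `σ` acting on the last `n` momenta, with the integrated momentum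
  -- left in place.
  filter_upwards [ae_cons (hψ (Equiv.Perm.decomposeFin.symm (0, σ)))] with K hK
  unfold annih
  congr 1
  refine integral_congr_ae ?_
  filter_upwards [hK] with k hk
  have e : (Fin.cons k K : Fin (n + 1) → R3) ∘ Equiv.Perm.decomposeFin.symm (0, σ)
      = Fin.cons k (K ∘ σ) := by
    funext i
    refine Fin.cases ?_ (fun i => ?_) i <;> simp
  rw [← hk, e]

theorem integral_conj_mul_annih (hf : MemLp f 2) (hψ : MemLp ψ 2) {χ : (Fin n → R3) → ℂ}
    (hχ : MemLp χ 2) : ∫ K, conj (χ K) * annih f n ψ K =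
      conj (∫ K : Fin (n + 1) → R3,
        conj (ψ K) * ((Real.sqrt (n + 1) : ℂ) * (f (K 0) * χ (Fin.tail K)))) := by
  have hi : Integrable fun K : Fin (n + 1) → R3 =>
      conj (conj (ψ K) * ((Real.sqrt (n + 1) : ℂ) * (f (K 0) * χ (Fin.tail K)))) := by
    refine integrable_conj ?_
    exact (((memLp_head_mul_tail hf hχ).const_mul (Real.sqrt (n + 1) : ℂ)).integrable_mul
      (p := 2) (q := 2) hψ.star).congr (Eventually.of_forall fun K => mul_comm _ _)
  rw [← integral_conj, ← integral_comp_of_measurePreserving (measurePreserving_cons n) hi.1]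
  have hi' := (measurePreserving_cons n).integrable_comp_of_integrable hi
  simp only [Function.comp_def] at hi'
  rw [integral_prod_symm _ hi']
  refine integral_congr_ae (Eventually.of_forall fun K => ?_)
  simp only [annih, ← integral_const_mul]
  refine integral_congr_ae (Eventually.of_forall fun k => ?_)
  simp only [Fin.cons_zero, Fin.tail_cons, map_mul, Complex.conj_conj, Complex.conj_ofReal]
  ring

end Annihilation

/-! ### The cutoff Hamiltonian in terms of bounded operators -/

theorem sector_single_same {n : ℕ} (χ : symL2 n) :
    sector (lp.single 2 n χ : Fock) n = (χ : L2n n) := by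
  simp only [sector, lp.coeFn_single, Pi.single_eq_same]

theorem sector_single_of_ne {n i : ℕ} (hi : i ≠ n) (χ : symL2 n) :
    sector (lp.single 2 n χ : Fock) i =ᵐ[volume] 0 := by
  simp only [sector, lp.coeFn_single, Pi.single_eq_of_ne hi]
  exact Lp.coeFn_zero _ _ _

section Components

variable {m : ∀ n, (Fin (n + 1) → R3) → ℂ} {U : Fock →L[ℂ] Fock}

/-- Testing against a vector supported in one sector leaves a single term of the sum. -/
theorem IsRaising.inner_apply_succ (hU : IsRaising m U) (Ψ : Fock) (n : ℕ) (χ : symL2 (n + 1)) :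
    inner ℂ χ (U Ψ (n + 1)) =
      ∫ K, conj ((χ : L2n (n + 1)) K) * (m n K * sector Ψ n (Fin.tail K)) := by
  have h := (hU (lp.single 2 (n + 1) χ) Ψ).2
  rw [lp.inner_single_left] at h
  rw [h.unique (hasSum_single n fun i hi => ?_), sector_single_same]
  rw [← integral_zero (Fin (i + 1) → R3) ℂ]
  refine integral_congr_ae ?_
  filter_upwards [sector_single_of_ne (show i + 1 ≠ n + 1 by omega) χ] with K hK
  simp [hK]

theorem IsRaising.apply_zero (hU : IsRaising m U) (Ψ : Fock) : U Ψ 0 = 0 := by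
  refine ext_inner_left ℂ fun χ => ?_
  have h := (hU (lp.single 2 0 χ) Ψ).2
  rw [lp.inner_single_left] at h
  rw [inner_zero_right]
  refine h.unique ?_
  have e : (fun n => ∫ K : Fin (n + 1) → R3, conj (sector (lp.single 2 0 χ : Fock) (n + 1) K) *
      (m n K * sector Ψ n (Fin.tail K))) = fun _ => 0 := by
    funext i
    rw [← integral_zero (Fin (i + 1) → R3) ℂ]
    refine integral_congr_ae ?_
    filter_upwards [sector_single_of_ne (Nat.succ_ne_zero i) χ] with K hK
    simp [hK]
  rw [e]
  exact hasSum_zero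

theorem IsRaising.inner_adjoint_apply (hU : IsRaising m U) (Ψ : Fock) (n : ℕ) (χ : symL2 n) :
    inner ℂ χ (ContinuousLinearMap.adjoint U Ψ n) =
      conj (∫ K, conj (sector Ψ (n + 1) K) * (m n K * (χ : L2n n) (Fin.tail K))) := by
  refine (lp.inner_single_left (𝕜 := ℂ) n χ (ContinuousLinearMap.adjoint U Ψ)).symm.trans ?_
  rw [ContinuousLinearMap.adjoint_inner_right, ← inner_conj_symm]
  congr 1
  have h := (hU Ψ (lp.single 2 n χ)).2
  rw [h.unique (hasSum_single n fun i hi => ?_), sector_single_same]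
  rw [← integral_zero (Fin (i + 1) → R3) ℂ]
  refine integral_congr_ae ?_
  filter_upwards [ae_tail (sector_single_of_ne hi χ)] with K hK
  simp [hK]

end Components

theorem isSymm_sector (Ψ : Fock) (n : ℕ) : IsSymm (sector Ψ n) := sector_perm Ψ n

/-- The integral kernel of `a*(f) H₀^{-1/2}`. -/
noncomputable def creationKernel (P : R3) (f : R3 → ℂ) (n : ℕ) (K : Fin (n + 1) → R3) : ℂ :=
  (Real.sqrt (n + 1) : ℂ) * f (K 0) * (invSqrtSymbol P n (Fin.tail K) : ℂ)

/-- The integral kernel of `H₀^{-1/2} a*(f)`. -/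
noncomputable def dualCreationKernel (P : R3) (f : R3 → ℂ) (n : ℕ) (K : Fin (n + 1) → R3) : ℂ :=
  (Real.sqrt (n + 1) : ℂ) * f (K 0) * (invSqrtSymbol P (n + 1) K : ℂ)

/-- The number operator alone suffices here. For a square integrable form factor, one `H₀^{-1/2}` on
either side of `a*(f)` thus compensates `√(n + 1)`; the cases `i = n` and `i = n + 1` are those two
sides. -/
theorem sqrt_mul_invSqrtSymbol_le_one (P : R3) {n i : ℕ} (hi : n ≤ i) (K : Fin i → R3) :
    Real.sqrt (n + 1) * invSqrtSymbol P i K ≤ 1 := by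
  rw [invSqrtSymbol, ← div_eq_mul_inv, div_le_one (sqrt_freeSymbol_pos P i K)]
  refine Real.sqrt_le_sqrt ?_
  have : (n : ℝ) ≤ i := by exact_mod_cast hi
  rw [freeSymbol]
  nlinarith [sq_nonneg ‖P - ∑ j, K j‖]

theorem norm_sqrt_mul_le (P : R3) {n i : ℕ} (hi : n ≤ i) (K : Fin i → R3) (c : ℂ) :
    ‖(Real.sqrt (n + 1) : ℂ) * c * (invSqrtSymbol P i K : ℂ)‖ ≤ ‖c‖ := by
  rw [mul_right_comm, norm_mul, ← Complex.ofReal_mul, Complex.norm_real, Real.norm_of_nonneg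
    (mul_nonneg (Real.sqrt_nonneg _) (invSqrtSymbol_pos P i K).le)]
  exact mul_le_of_le_one_left (norm_nonneg _) (sqrt_mul_invSqrtSymbol_le_one P hi K)

section Cutoff

variable {P : R3} {f : R3 → ℂ}

theorem exists_creation (P : R3) (hf : Measurable f) (hf2 : MemLp f 2) :
    ∃ D : Fock →L[ℂ] Fock, ‖D‖ ≤ (eLpNorm f 2).toReal ∧ IsRaising (creationKernel P f) D := by
  refine exists_raisingOperator _ (fun n => ?_) hf2 fun n K => norm_sqrt_mul_le P le_rfl _ _
  have h1 := (measurable_invSqrtSymbol P n).comp (measurable_tail n)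
  have h3 : Measurable fun K : Fin (n + 1) → R3 => f (K 0) := hf.comp (measurable_pi_apply 0)
  exact (h3.const_mul _).mul (Complex.measurable_ofReal.comp h1)

theorem exists_dualCreation (P : R3) (hf : Measurable f) (hf2 : MemLp f 2) :
    ∃ A : Fock →L[ℂ] Fock, ‖A‖ ≤ (eLpNorm f 2).toReal ∧
      IsRaising (dualCreationKernel P f) A := by
  refine exists_raisingOperator _ (fun n => ?_) hf2 fun n K =>
    norm_sqrt_mul_le P (Nat.le_succ n) _ _
  have h3 : Measurable fun K : Fin (n + 1) → R3 => f (K 0) := hf.comp (measurable_pi_apply 0)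
  exact (h3.const_mul _).mul
    (Complex.measurable_ofReal.comp (measurable_invSqrtSymbol P (n + 1)))

theorem inner_invSqrt (P : R3) (Φ Ψ : Fock) :
    inner ℂ (invSqrt P Φ) Ψ = inner ℂ Φ (invSqrt P Ψ) :=
  ContinuousLinearMap.isSelfAdjoint_iff_isSymmetric.1 (isSelfAdjoint_invSqrt P) Φ Ψ

theorem IsRaising.invSqrt_mul {D : Fock →L[ℂ] Fock} (hD : IsRaising (creationKernel P f) D) :
    IsRaising (couplingKernel P f) (invSqrt P * D) := by
  intro Φ Ψ
  have e : ∀ n, (fun K : Fin (n + 1) → R3 => conj (sector (invSqrt P Φ) (n + 1) K) *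
      (creationKernel P f n K * sector Ψ n (Fin.tail K))) =ᵐ[volume]
      fun K => conj (sector Φ (n + 1) K) * (couplingKernel P f n K * sector Ψ n (Fin.tail K)) :=
    fun n => by
      filter_upwards [sector_invSqrt P Φ (n + 1)] with K hK
      rw [hK, creationKernel, couplingKernel, map_mul, Complex.conj_ofReal]
      ring
  obtain ⟨h1, h2⟩ := hD (invSqrt P Φ) Ψ
  refine ⟨fun n => (h1 n).congr (e n), ?_⟩
  simp only [fun n => integral_congr_ae (e n)] at h2
  rw [inner_invSqrt] at h2
  exact h2

theorem IsRaising.mul_invSqrt {A : Fock →L[ℂ] Fock} (hA : IsRaising (dualCreationKernel P f) A) :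
    IsRaising (couplingKernel P f) (A * invSqrt P) := by
  intro Φ Ψ
  have e : ∀ n, (fun K : Fin (n + 1) → R3 => conj (sector Φ (n + 1) K) *
      (dualCreationKernel P f n K * sector (invSqrt P Ψ) n (Fin.tail K))) =ᵐ[volume]
      fun K => conj (sector Φ (n + 1) K) * (couplingKernel P f n K * sector Ψ n (Fin.tail K)) :=
    fun n => by
      filter_upwards [ae_tail (sector_invSqrt P Ψ n)] with K hK
      rw [hK, dualCreationKernel, couplingKernel]
      ring
  obtain ⟨h1, h2⟩ := hA Φ (invSqrt P Ψ)
  refine ⟨fun n => (h1 n).congr (e n), ?_⟩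
  simp only [fun n => integral_congr_ae (e n)] at h2
  exact h2

/-- `D Ψ` and `a*(f) T Ψ` are both symmetric and have the same pairing with every symmetric `χ`. -/
theorem sector_creation (hf2 : MemLp f 2) {D : Fock →L[ℂ] Fock}
    (hD : IsRaising (creationKernel P f) D) (Ψ : Fock) (n : ℕ) :
    sector (D Ψ) n =ᵐ[volume] creatSector f (invSqrt P Ψ) n := by
  cases n with
  | zero =>
    have h : ((D Ψ 0 : symL2 0) : L2n 0) = 0 := by rw [hD.apply_zero]; rfl
    unfold sector
    rw [h]
    exact Lp.coeFn_zero _ _ _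
  | succ n =>
    have hm := memLp_creat hf2 (memLp_sector (invSqrt P Ψ) n)
    have hs := isSymm_creat (f := f) (isSymm_sector (invSqrt P Ψ) n)
    have hc := hm.coeFn_toLp
    have hmem : hm.toLp ∈ symL2 (n + 1) := fun σ => by
      filter_upwards [hc, (measurePreserving_perm _ σ).quasiMeasurePreserving.ae_eq_comp hc, hs σ]
        with K h1 h2 h3
      simp only [Function.comp_apply] at h2
      rw [h2, h1, h3]
    have key : D Ψ (n + 1) = ⟨hm.toLp, hmem⟩ := by
      refine ext_inner_left ℂ fun χ => ?_
      rw [hD.inner_apply_succ, Submodule.coe_inner, L2n_inner_eq]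
      have h1 : ∫ K, conj ((χ : L2n (n + 1)) K) * (MemLp.toLp _ hm : L2n (n + 1)) K =
          ∫ K, conj ((χ : L2n (n + 1)) K) * creat f n (sector (invSqrt P Ψ) n) K := by
        refine integral_congr_ae ?_
        filter_upwards [hc] with K hK
        rw [hK]
      rw [h1, integral_conj_mul_creat hf2 (memLp_sector _ _) (Lp.memLp _) χ.2]
      refine integral_congr_ae ?_
      filter_upwards [ae_tail (sector_invSqrt P Ψ n)] with K hK
      rw [hK, creationKernel]
      ring
    unfold sector at hc ⊢
    rw [key]
    exact hc

/-- `A` is `T a*(f)`, so its adjoint is `a(f) T`; again it is enough to compare pairings. -/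
theorem sector_annihilation (hf2 : MemLp f 2) {A : Fock →L[ℂ] Fock}
    (hA : IsRaising (dualCreationKernel P f) A) (Ψ : Fock) (n : ℕ) :
    sector (ContinuousLinearMap.adjoint A Ψ) n =ᵐ[volume]
      annih f n (sector (invSqrt P Ψ) (n + 1)) := by
  have hm := memLp_annih hf2 (memLp_sector (invSqrt P Ψ) (n + 1))
  have hs := isSymm_annih (f := f) (isSymm_sector (invSqrt P Ψ) (n + 1))
  have hc := hm.coeFn_toLp
  have hmem : hm.toLp ∈ symL2 n := fun σ => by
    filter_upwards [hc, (measurePreserving_perm _ σ).quasiMeasurePreserving.ae_eq_comp hc, hs σ]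
      with K h1 h2 h3
    simp only [Function.comp_apply] at h2
    rw [h2, h1, h3]
  have key : ContinuousLinearMap.adjoint A Ψ n = ⟨hm.toLp, hmem⟩ := by
    refine ext_inner_left ℂ fun χ => ?_
    rw [hA.inner_adjoint_apply, Submodule.coe_inner, L2n_inner_eq]
    have h1 : ∫ K, conj ((χ : L2n n) K) * (MemLp.toLp _ hm : L2n n) K =
        ∫ K, conj ((χ : L2n n) K) * annih f n (sector (invSqrt P Ψ) (n + 1)) K := by
      refine integral_congr_ae ?_
      filter_upwards [hc] with K hK
      rw [hK]
    rw [h1, integral_conj_mul_annih hf2 (memLp_sector _ _) (Lp.memLp _)]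
    congr 1
    refine integral_congr_ae ?_
    filter_upwards [sector_invSqrt P Ψ (n + 1)] with K hK
    rw [hK, dualCreationKernel, map_mul, Complex.conj_ofReal]
    ring
  unfold sector at hc ⊢
  rw [key]
  exact hc

/-- For `Ψ = T² x` one has `H₀ Ψ = x`, while `D = a*(f) T` and `A* = a(f) T` give the field term as
a bounded operator applied to `T x`. The left side is `η + Ψ` because the free part of the
Hamiltonian is `H₀ - 1`. -/
theorem mem_cutoffGraph_iff (α : ℝ) (hf2 : MemLp f 2) {D A : Fock →L[ℂ] Fock}
    (hD : IsRaising (creationKernel P f) D) (hA : IsRaising (dualCreationKernel P f) A)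
    (Ψ η : Fock) : (Ψ, η) ∈ cutoffGraph α f P ↔ ∃ x, invSqrt P (invSqrt P x) = Ψ ∧
      η + Ψ = x + ((Real.sqrt α : ℂ) • (D + ContinuousLinearMap.adjoint A)) (invSqrt P x) := by
  have hC : ∀ y n, sector (((Real.sqrt α : ℂ) • (D + ContinuousLinearMap.adjoint A)) y) n
      =ᵐ[volume] fun K => (Real.sqrt α : ℂ) * (annih f n (sector (invSqrt P y) (n + 1)) K +
        creatSector f (invSqrt P y) n K) := fun y n => by
    have e : ((Real.sqrt α : ℂ) • (D + ContinuousLinearMap.adjoint A)) y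
        = (Real.sqrt α : ℂ) • (D y + ContinuousLinearMap.adjoint A y) := rfl
    rw [e]
    filter_upwards [sector_smul (Real.sqrt α : ℂ) (D y + ContinuousLinearMap.adjoint A y) n,
      sector_add (D y) (ContinuousLinearMap.adjoint A y) n, sector_creation hf2 hD y n,
      sector_annihilation hf2 hA y n] with K h1 h2 h3 h4
    rw [h1, Pi.smul_apply, h2, Pi.add_apply, h3, h4, smul_eq_mul, add_comm (annih _ _ _ _)]
  constructor
  · rintro ⟨h1, -, h3⟩
    obtain ⟨x, hx⟩ := (mem_freeDomain_iff P Ψ).1 h1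
    subst hx
    refine ⟨x, rfl, Fock.ext_sector fun n => ?_⟩
    filter_upwards [h3 n, hC (invSqrt P x) n, freeSymbol_mul_sector P x n,
      sector_add η (invSqrt P (invSqrt P x)) n, sector_add x
        (((Real.sqrt α : ℂ) • (D + ContinuousLinearMap.adjoint A)) (invSqrt P x)) n]
      with K k1 k2 k3 k4 k5
    rw [k4, k5, Pi.add_apply, Pi.add_apply, k2, ← k3, k1]
    push_cast
    ring
  · rintro ⟨x, rfl, hx⟩
    refine ⟨(mem_freeDomain_iff P _).2 ⟨x, rfl⟩,
      fun n => annihConverges_of_memLp hf2 (memLp_sector _ _), fun n => ?_⟩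
    have hx' : sector (η + invSqrt P (invSqrt P x)) n = sector (x + ((Real.sqrt α : ℂ) •
        (D + ContinuousLinearMap.adjoint A)) (invSqrt P x)) n := by rw [hx]
    filter_upwards [hC (invSqrt P x) n, freeSymbol_mul_sector P x n,
      sector_add η (invSqrt P (invSqrt P x)) n, sector_add x
        (((Real.sqrt α : ℂ) • (D + ContinuousLinearMap.adjoint A)) (invSqrt P x)) n]
      with K k2 k3 k4 k5
    rw [hx', k5, Pi.add_apply, Pi.add_apply, k2, ← k3] at k4
    push_cast
    linear_combination -k4

end Cutoff

section Abstract

variable {H : Type*} [NormedAddCommGroup H] [InnerProductSpace ℂ H] [CompleteSpace H]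

/-- Both factorizations of `U` are needed to pull `T` out on the left: `U = T D`, and `U* = (A T)* =
T A*`. -/
theorem fieldPerturbation_eq_mul {T D A U : H →L[ℂ] H} (α : ℝ) (hT : IsSelfAdjoint T)
    (hD : U = T * D) (hA : U = A * T) :
    fieldPerturbation α U =
      T * ((Real.sqrt α : ℂ) • (D + ContinuousLinearMap.adjoint A)) := by
  have h : star U = T * ContinuousLinearMap.adjoint A := by
    rw [hA, star_mul, hT.star_eq]
    rfl
  rw [fieldPerturbation, h, mul_smul_comm, mul_add, ← hD]

theorem norm_smul_add_adjoint_le {D A : H →L[ℂ] H} {α M : ℝ} (hD : ‖D‖ ≤ M) (hA : ‖A‖ ≤ M) :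
    ‖(Real.sqrt α : ℂ) • (D + ContinuousLinearMap.adjoint A)‖ ≤ 2 * Real.sqrt α * M := by
  rw [norm_smul, Complex.norm_real, Real.norm_of_nonneg (Real.sqrt_nonneg _)]
  have h := norm_add_le D (ContinuousLinearMap.adjoint A)
  rw [LinearIsometryEquiv.norm_map] at h
  nlinarith [Real.sqrt_nonneg α]

end Abstract

/-- The cutoff coupling operator factors as `H₀^{-1/2} C` with `C` bounded uniformly in the total
momentum, and it determines the graph of the cutoff Hamiltonian. -/
theorem exists_cutoff_coupling (α Λ : ℝ) (P : R3) : ∃ U C : Fock →L[ℂ] Fock,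
    IsRaising (couplingKernel P (vHatCut Λ)) U ∧
    ‖C‖ ≤ 2 * Real.sqrt α * (eLpNorm (vHatCut Λ) 2).toReal ∧
    fieldPerturbation α U = invSqrt P * C ∧
    ∀ Ψ η, (Ψ, η) ∈ cutoffGraph α (vHatCut Λ) P ↔
      ∃ x, invSqrt P (invSqrt P x) = Ψ ∧ η + Ψ = x + C (invSqrt P x) := by
  obtain ⟨D, hD, hD'⟩ := exists_creation P (measurable_vHatCut Λ) (memLp_vHatCut Λ)
  obtain ⟨A, hA, hA'⟩ := exists_dualCreation P (measurable_vHatCut Λ) (memLp_vHatCut Λ)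
  exact ⟨invSqrt P * D, _, hD'.invSqrt_mul, norm_smul_add_adjoint_le hD hA,
    fieldPerturbation_eq_mul α (isSelfAdjoint_invSqrt P) rfl
      (hD'.invSqrt_mul.ext hA'.mul_invSqrt), mem_cutoffGraph_iff α (memLp_vHatCut Λ) hD' hA'⟩

/-! ### Self-adjointness and norm-resolvent convergence -/

theorem isShiftedInverse_cutoffHamiltonian {α Λ l c : ℝ} {P : R3} {B C : Fock →L[ℂ] Fock}
    (hBC : B = invSqrt P * C) (hc : 0 < c) (hb : BoundedBelow (pencil (invSqrt P) B l) c)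
    (hC : ∀ Ψ η, (Ψ, η) ∈ cutoffGraph α (vHatCut Λ) P ↔
      ∃ x, invSqrt P (invSqrt P x) = Ψ ∧ η + Ψ = x + C (invSqrt P x)) :
    IsShiftedInverse (cutoffHamiltonian α Λ P) l (pencilInverse (invSqrt P) B l) := fun Ψ η => by
  rw [cutoffHamiltonian_graph, hC, ← exists_form_eq_iff hBC, eq_pencilInverse_iff (hb.isUnit hc)]

theorem isShiftedInverse_fiberHamiltonian {α l c : ℝ} {P : R3} {U : Fock →L[ℂ] Fock}
    (hU : IsRaising (couplingKernel P vHat) U) (hc : 0 < c)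
    (hb : BoundedBelow (pencil (invSqrt P) (fieldPerturbation α U) l) c) :
    IsShiftedInverse (fiberHamiltonian α P) l
      (pencilInverse (invSqrt P) (fieldPerturbation α U) l) := fun Ψ η => by
  rw [fiberHamiltonian_graph, mem_fiberGraph_iff α hU, eq_pencilInverse_iff (hb.isUnit hc)]

/-- With a cutoff the factorization `B = T C` is exact, so the small remainder is `0`; the shift may
depend on `Λ` here, and every `Λ` is covered. -/
theorem cutoffHamiltonian_isSelfAdjoint (α Λ : ℝ) (P : R3) :
    IsSelfAdjoint (cutoffHamiltonian α Λ P) := by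
  obtain ⟨U, C, -, hCM, hBC, hC⟩ := exists_cutoff_coupling α Λ P
  have hb := boundedBelow_pencil (isSelfAdjoint_invSqrt P) hCM (E := 0) norm_zero.le
    (hBC.trans (add_zero _).symm)
  exact (isShiftedInverse_cutoffHamiltonian hBC (by norm_num) hb hC).isSelfAdjoint
    (isSelfAdjoint_pencilInverse (isSelfAdjoint_invSqrt P)
      (isSelfAdjoint_fieldPerturbation α U) _)

theorem cutoffHamiltonian_domain (α Λ : ℝ) (P : R3) :
    (cutoffHamiltonian α Λ P).domain = freeDomain P := by
  obtain ⟨U, C, -, -, -, hC⟩ := exists_cutoff_coupling α Λ P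
  ext Ψ
  rw [mem_freeDomain_iff, LinearPMap.mem_domain_iff, cutoffHamiltonian_graph]
  constructor
  · rintro ⟨η, h⟩
    obtain ⟨x, hx, -⟩ := (hC Ψ η).1 h
    exact ⟨x, hx⟩
  · rintro ⟨x, hx⟩
    -- Since `C` is bounded on the whole space, the graph equation can be solved for `η` whatever
    -- `x` is.
    exact ⟨x + C (invSqrt P x) - Ψ, (hC _ _).2 ⟨x, hx, sub_add_cancel _ _⟩⟩

/-- With a common shift `l`, the inverses of `H_Λ(P) + l` (for large `Λ`) and of `H(P) + l` are
bounded and self-adjoint, and they converge uniformly in `P`. -/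
theorem exists_uniform_inverses (α : ℝ) :
    ∃ (l Λ₀ : ℝ) (R : ℝ → R3 → Fock →L[ℂ] Fock) (S : R3 → Fock →L[ℂ] Fock) (δ : ℝ → ℝ),
      (∀ P, IsSelfAdjoint (S P) ∧ IsShiftedInverse (fiberHamiltonian α P) l (S P)) ∧
      (∀ Λ ≥ Λ₀, ∀ P, IsSelfAdjoint (R Λ P) ∧
        IsShiftedInverse (cutoffHamiltonian α Λ P) l (R Λ P) ∧ ‖R Λ P - S P‖ ≤ δ Λ) ∧
      Tendsto δ atTop (𝓝 0) := by
  set d : ℝ → ℝ := fun Λ =>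
    2 * Real.sqrt α * (eLpNorm (weighted (vHat - vHatCut Λ)) 2).toReal with hd
  have hd0 : Tendsto d atTop (𝓝 0) := by
    simpa using tendsto_eLpNorm_weighted_sub_vHatCut.const_mul (2 * Real.sqrt α)
  -- With `1/8` here, `B` and every `B_Λ` with `Λ ≥ Λ₀` are within `1/8 + 1/8 = 1/4` of `B_{Λ₀}`,
  -- and the lower bound `3/4 - 1/4 = 1/2` remains.
  obtain ⟨Λ₀, hΛ₀⟩ := eventually_atTop.1 (hd0.eventually_le_const (by norm_num : (0 : ℝ) < 1 / 8))
  choose V _ hV using fun P => exists_coupling P measurable_vHat memLp_weighted_vHat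
  choose U C hU hCM hBC hC using exists_cutoff_coupling α
  have hdist : ∀ Λ P, ‖fieldPerturbation α (V P) - fieldPerturbation α (U Λ P)‖ ≤ d Λ :=
    fun Λ P => (norm_fieldPerturbation_sub_le α _ _).trans (mul_le_mul_of_nonneg_left
      (norm_coupling_sub_le measurable_vHat (measurable_vHatCut Λ) (memLp_weighted_sub_vHatCut Λ)
        (hV P) (hU Λ P)) (by positivity))
  -- `M` is taken at the fixed cutoff `Λ₀`: the bound on `C` grows with the cutoff, so `C` at a
  -- variable `Λ` would not give a common shift.
  set M := 2 * Real.sqrt α * (eLpNorm (vHatCut Λ₀) 2).toReal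
  set l := 1 + M ^ 2 with hl
  have hbelow : ∀ P (B : Fock →L[ℂ] Fock), ‖B - fieldPerturbation α (U Λ₀ P)‖ ≤ 1 / 4 →
      BoundedBelow (pencil (invSqrt P) B l) (1 / 2) := fun P B hB => by
    have h := boundedBelow_pencil (isSelfAdjoint_invSqrt P) (hCM Λ₀ P) hB
      (B := B) (by rw [← hBC, add_sub_cancel])
    norm_num at h
    exact h
  have hbV : ∀ P, BoundedBelow (pencil (invSqrt P) (fieldPerturbation α (V P)) l) (1 / 2) :=
    fun P => hbelow P _ (by linarith [hdist Λ₀ P, hΛ₀ Λ₀ le_rfl])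
  have hbU : ∀ Λ ≥ Λ₀, ∀ P,
      BoundedBelow (pencil (invSqrt P) (fieldPerturbation α (U Λ P)) l) (1 / 2) :=
    fun Λ hΛ P => hbelow P _ (by
      have h1 := norm_sub_le_norm_sub_add_norm_sub (fieldPerturbation α (U Λ P))
        (fieldPerturbation α (V P)) (fieldPerturbation α (U Λ₀ P))
      rw [norm_sub_rev (fieldPerturbation α (U Λ P)) (fieldPerturbation α (V P))] at h1
      linarith [hdist Λ P, hdist Λ₀ P, hΛ₀ Λ₀ le_rfl, hΛ₀ Λ hΛ])
  refine ⟨l, Λ₀, fun Λ P => pencilInverse (invSqrt P) (fieldPerturbation α (U Λ P)) l,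
    fun P => pencilInverse (invSqrt P) (fieldPerturbation α (V P)) l,
    fun Λ => ((1 / 2 : ℝ)⁻¹) ^ 2 * d Λ, fun P => ⟨?_, ?_⟩, fun Λ hΛ P => ⟨?_, ?_, ?_⟩, ?_⟩
  · exact isSelfAdjoint_pencilInverse (isSelfAdjoint_invSqrt P)
      (isSelfAdjoint_fieldPerturbation α _) _
  · exact isShiftedInverse_fiberHamiltonian (hV P) (by norm_num) (hbV P)
  · exact isSelfAdjoint_pencilInverse (isSelfAdjoint_invSqrt P)
      (isSelfAdjoint_fieldPerturbation α _) _
  · exact isShiftedInverse_cutoffHamiltonian (hBC Λ P) (by norm_num) (hbU Λ hΛ P) (hC Λ P)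
  · refine (norm_pencilInverse_sub_le (by norm_num) (norm_invSqrt_le P) (hbU Λ hΛ P)
      (hbV P)).trans ?_
    rw [norm_sub_rev]
    exact mul_le_mul_of_nonneg_left (hdist Λ P) (by positivity)
  · simpa using hd0.const_mul (((1 / 2 : ℝ)⁻¹) ^ 2)

theorem tendstoUniformly_of_norm_sub_lt {ι X H : Type*} [NormedAddCommGroup H]
    [InnerProductSpace ℂ H] {p : Filter ι} {F : ι → X → H →L[ℂ] H} {G : X → H →L[ℂ] H}
    (h : ∀ ε > 0, ∀ᶠ i in p, ∀ x, ‖F i x - G x‖ < ε) : TendstoUniformly F G p := by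
  rw [Metric.tendstoUniformly_iff]
  intro ε hε
  filter_upwards [h ε hε] with i hi x
  rw [dist_comm, dist_eq_norm]
  exact hi x

/-- The common shift makes `w = z + l` independent of `Λ` and `P`, so the constant in
`norm_resolventOf_sub_le` is fixed and the uniform rate `δ` survives. -/
theorem normResolventTendstoUniformly_cutoffHamiltonian (α : ℝ) :
    NormResolventTendstoUniformly atTop (fun (Λ : ℝ) (P : R3) => cutoffHamiltonian α Λ P)
      (fun P : R3 => fiberHamiltonian α P) := by
  obtain ⟨l, Λ₀, R, S, δ, hS, hR, hδ⟩ := exists_uniform_inverses α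
  intro z hz
  have hw : (z + l).im ≠ 0 := by simpa using hz
  refine ⟨fun Λ P => resolventOf (R Λ P) (z + l), fun P => resolventOf (S P) (z + l), ?_,
    fun P => (hS P).2.resolventOf_apply_eq_iff (hS P).1 hz, ?_⟩
  · filter_upwards [eventually_ge_atTop Λ₀] with Λ hΛ P
    exact (hR Λ hΛ P).2.1.resolventOf_apply_eq_iff (hR Λ hΛ P).1 hz
  · refine tendstoUniformly_of_norm_sub_lt fun ε hε => ?_
    have h1 := hδ.const_mul ((1 + ‖z + l‖ * |(z + l).im|⁻¹) ^ 2)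
    rw [mul_zero] at h1
    filter_upwards [h1.eventually_lt_const hε, eventually_ge_atTop Λ₀] with Λ h2 hΛ P
    refine lt_of_le_of_lt ?_ h2
    exact (norm_resolventOf_sub_le (hR Λ hΛ P).1 (hS P).1 hw).trans
      (mul_le_mul_of_nonneg_left (hR Λ hΛ P).2.2 (by positivity))

theorem fiberHamiltonian_isSelfAdjoint (α : ℝ) (P : R3) :
    IsSelfAdjoint (fiberHamiltonian α P) := by
  obtain ⟨l, -, -, S, -, hS, -⟩ := exists_uniform_inverses α
  exact (hS P).2.isSelfAdjoint (hS P).1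

end Polaron

theorem propositionA2 (α : ℝ) (hα : 0 < α) :
    (∀ Λ : ℝ, 0 < Λ → ∀ P : Polaron.R3,
      (Polaron.cutoffHamiltonian α Λ P).domain = Polaron.freeDomain P ∧
        IsSelfAdjoint (Polaron.cutoffHamiltonian α Λ P)) ∧
    (∀ P : Polaron.R3, IsSelfAdjoint (Polaron.fiberHamiltonian α P)) ∧
    Polaron.NormResolventTendstoUniformly atTop
      (fun (Λ : ℝ) (P : Polaron.R3) => Polaron.cutoffHamiltonian α Λ P)
      (fun P : Polaron.R3 => Polaron.fiberHamiltonian α P) :=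
  ⟨fun Λ _ P => ⟨Polaron.cutoffHamiltonian_domain α Λ P,
      Polaron.cutoffHamiltonian_isSelfAdjoint α Λ P⟩,
    Polaron.fiberHamiltonian_isSelfAdjoint α,
    Polaron.normResolventTendstoUniformly_cutoffHamiltonian α⟩
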